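/- Let $0<\alpha<1$, $0<\theta<1$, $\Lambda>1$ and $I=[(1-\theta)/\Lambda,\,1-\theta/\Lambda]\subset(0,1)$. For $v_0\in I$ consider the scalar free boundary problem: find $c>0$, $0<R<\infty$ and a nonnegative $v\in C^\infty([0,R))\cap C^1([0,R])$ such that $$\Lambda v''-cv'=v^{\alpha}\ \text{ on }(0,R),\qquad v(0)=v_0,\quad v'(0)=-\frac{c}{\Lambda}(1-v_0),\qquad v(R)=v'(R)=0. \tag{1}$$ For every $v_0\in I$, problem (1) has exactly one solution, denoted $(c(v_0),R(v_0),v(v_0;\cdot))$. Let $P:\mathbb R\to I$ be the projection ($P(x)=x$ for $x\in I$, $P(x)=(1-\theta)/\Lambda$ for $x\le(1-\theta)/\Lambda$, $P(x)=1-\theta/\Lambda$ for $x\ge 1-\theta/\Lambda$) and define $\Psi:I\to I$ by $$\Psi(v_0)=P\left(\frac1\Lambda\left[1-\theta-c(v_0)(1-\Lambda)\int_0^{R(v_0)}e^{-c(v_0)s}\,v(v_0;s)\,ds\right]\right).$$ Then $\Psi$ has a fixed point. Moreover, for every fixed point $v_0^*\in I$ of $\Psi$, the triple $(c,R,v)=(c(v_0^*),R(v_0^*),v(v_0^*;\cdot))$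 solves the system $$\Lambda v''-cv'=v^{\alpha}\ \text{ on }(0,R),\qquad 0<v(0)<1,\quad v'(0)=-\frac{c}{\Lambda}(1-v(0)),\qquad v(R)=v'(R)=0,$$ with $v(0)=v_0^*$, together with the integral equation $$\theta+\Lambda v(0)=1-c(1-\Lambda)\int_0^R e^{-cs}v(s)\,ds,$$ and also with its equivalent form $$\theta+v(0)=1-(1-\Lambda)\int_0^R e^{-cs}v'(s)\,ds.$$ -/

import Mathlib

open Set
open scoped ContDiff

noncomputable section

namespace CombustionWave

/-- `(c, R, v)` solves the scalar one-phase free boundary problem with prescribed value `v(0) = v₀`: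
`Λ v'' - c v' = v ^ α` on `(0, R)`, `v(0) = v₀`, `v'(0) = -(c / Λ) (1 - v₀)`, `v(R) = v'(R) = 0`,
where `c > 0`, `0 < R < ∞` and `v` belongs to `C^∞([0, R)) ∩ C^1([0, R])`.
The power `v ^ α` with a real exponent presupposes `v ≥ 0`. Only the values of `v` on `[0, R]` matter;
derivatives at the end points are one-sided. -/
structure IsScalarSolution (α Λ v₀ c R : ℝ) (v : ℝ → ℝ) : Prop where
  c_pos : 0 < c
  R_pos : 0 < R
  smooth : ContDiffOn ℝ ∞ v (Ico 0 R)
  contDiffOn_one : ContDiffOn ℝ 1 v (Icc 0 R)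
  nonneg : ∀ ξ ∈ Icc 0 R, 0 ≤ v ξ
  ode : ∀ ξ ∈ Ioo 0 R, Λ * deriv (deriv v) ξ - c * deriv v ξ = v ξ ^ α
  value_zero : v 0 = v₀
  deriv_zero : derivWithin v (Icc 0 R) 0 = -(c / Λ) * (1 - v₀)
  value_R : v R = 0
  deriv_R : derivWithin v (Icc 0 R) R = 0

/-- The scalar problem in which `v(0)` is not prescribed, but only required to lie in `(0, 1)`. -/
def SolvesScalarProblem (α Λ c R : ℝ) (v : ℝ → ℝ) : Prop :=
  0 < v 0 ∧ v 0 < 1 ∧ IsScalarSolution α Λ (v 0) c R v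

/-- The solution `(c(v₀), R(v₀), v(v₀; ·))` of the scalar problem with `v(0) = v₀`, picked by choice
(an arbitrary triple if there is no solution). -/
def scalarSolution (α Λ v₀ : ℝ) : ℝ × ℝ × (ℝ → ℝ) :=
  Classical.epsilon fun p : ℝ × ℝ × (ℝ → ℝ) => IsScalarSolution α Λ v₀ p.1 p.2.1 p.2.2

/-- The velocity `c(v₀)`. -/
def speed (α Λ v₀ : ℝ) : ℝ := (scalarSolution α Λ v₀).1

/-- The free boundary `R(v₀)`. -/
def radius (α Λ v₀ : ℝ) : ℝ := (scalarSolution α Λ v₀).2.1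

/-- The function `ξ ↦ v(v₀; ξ)`. -/
def profile (α Λ v₀ : ℝ) : ℝ → ℝ := (scalarSolution α Λ v₀).2.2

theorem left_le_right (θ : ℝ) {Λ : ℝ} (hΛ : 1 < Λ) : (1 - θ) / Λ ≤ 1 - θ / Λ := by
  have h0 : (0 : ℝ) < Λ := by linarith
  rw [sub_div]
  have : 1 / Λ ≤ 1 := by rw [div_le_one h0]; exact hΛ.le
  linarith

/-- The interval `I = [(1 - θ) / Λ, 1 - θ / Λ]`. -/
def I (θ Λ : ℝ) : Set ℝ := Icc ((1 - θ) / Λ) (1 - θ / Λ)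

/-- The projection `P : ℝ → I`: the identity inside `I`, constant on either side of `I`. -/
def P (θ : ℝ) {Λ : ℝ} (hΛ : 1 < Λ) : ℝ → I θ Λ := projIcc _ _ (left_le_right θ hΛ)

/-- The map `Ψ : I → I`,
`Ψ(v₀) = P ((1 / Λ) [1 - θ - c(v₀) (1 - Λ) ∫₀^{R(v₀)} e^{-c(v₀) s} v(v₀; s) ds])`. -/
def Psi (α θ : ℝ) {Λ : ℝ} (hΛ : 1 < Λ) (v₀ : I θ Λ) : I θ Λ :=
  P θ hΛ ((1 / Λ) * (1 - θ - speed α Λ v₀ * (1 - Λ) *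
    ∫ s in (0 : ℝ)..radius α Λ v₀, Real.exp (-speed α Λ v₀ * s) * profile α Λ v₀ s))

/-- The integral equation `θ + Λ v(0) = 1 - c (1 - Λ) ∫₀^R e^{-c s} v(s) ds`. -/
def IntegralEq (θ Λ c R : ℝ) (v : ℝ → ℝ) : Prop :=
  θ + Λ * v 0 = 1 - c * (1 - Λ) * ∫ s in (0 : ℝ)..R, Real.exp (-c * s) * v s

/-- The integral equation `θ + v(0) = 1 - (1 - Λ) ∫₀^R e^{-c s} v'(s) ds`. -/
def IntegralEqDeriv (θ Λ c R : ℝ) (v : ℝ → ℝ) : Prop :=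
  θ + v 0 = 1 - (1 - Λ) * ∫ s in (0 : ℝ)..R, Real.exp (-c * s) * derivWithin v (Icc 0 R) s

end CombustionWave

end

/-! ### Comparison for the system `X' = Y - X`, `Y' = X ^ α`. -/

namespace CombustionWave

/-! Put `κ = c / Λ`, `t = κ (R - ξ)` and `v = A X(t)` with `Λ κ² A = A ^ α`. The equation becomes
`X'' + X' = X ^ α` with `X(0) = X'(0) = 0`, free of all parameters but `α`. It has a solution `U`
positive for `t > 0` (`exists_isUniversalProfile`). Write `F = U + U'` and `T = κ R`. The condition
on `v'(0)` reads `A F(T) = 1` and `v(0) = v₀` reads `U(T) / F(T) = v₀`; then `κ` is determined by `Λ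
κ² = F(T) ^ (1 - α)`. So solutions correspond to roots `T` of `U / F = v₀`. The ratio `U / F`
increases strictly and takes every value in `(0, 1)`, whence existence and uniqueness.

Uniqueness needs care because `x ^ α` is not Lipschitz at `0`: the zero solution and all delayed
copies of `U` have the same initial data. Comparison (`IsSystemSolution.le_of_pos`) shows that
delays of `U` are the only nonzero possibilities (`exists_eq_translate`). A positive delay makes `v`
vanish before `R` and leave zero like a power, which contradicts smoothness on `[0, R)`
(`not_contDiffOn_of_mul_rpow_le`).

For the fixed point, `T` replaces `v₀` as parameter. The integral in `Ψ` becomes the explicit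
continuous function `moment`, and the intermediate value theorem suffices. Since `0 ≤ moment ≤ U / F
= v₀ < 1`, the argument of `P` already lies in `I`, so the projection is inactive and the fixed
point equation is the integral equation. -/

theorem monotoneOn_Icc_of_hasDerivAt {f f' : ℝ → ℝ} {a b : ℝ} (hc : ContinuousOn f (Icc a b))
    (hd : ∀ t ∈ Ioo a b, HasDerivAt f (f' t) t) (h0 : ∀ t ∈ Ioo a b, 0 ≤ f' t) :
    MonotoneOn f (Icc a b) := by
  refine monotoneOn_of_deriv_nonneg (convex_Icc a b) hc ?_ ?_
  · rw [interior_Icc]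
    exact fun t ht => (hd t ht).differentiableAt.differentiableWithinAt
  · rw [interior_Icc]
    intro t ht
    rw [(hd t ht).deriv]
    exact h0 t ht

/-- `(X, Y)` is a nonnegative solution on `[a, b]` of the first order system `X' = Y - X`, `Y' = X ^ α`,
that is, of `X'' + X' = X ^ α` with `Y = X + X'`. -/
structure IsSystemSolution (α a b : ℝ) (X Y : ℝ → ℝ) : Prop where
  cont_fst : ContinuousOn X (Icc a b)
  cont_snd : ContinuousOn Y (Icc a b)
  deriv_fst : ∀ t ∈ Ioo a b, HasDerivAt X (Y t - X t) t
  deriv_snd : ∀ t ∈ Ioo a b, HasDerivAt Y (X t ^ α) t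
  nonneg : ∀ t ∈ Icc a b, 0 ≤ X t

namespace IsSystemSolution

variable {α a b : ℝ} {X Y X₁ Y₁ X₂ Y₂ : ℝ → ℝ}

theorem mono (h : IsSystemSolution α a b X Y) {a' b' : ℝ} (ha : a ≤ a') (hb : b' ≤ b) :
    IsSystemSolution α a' b' X Y where
  cont_fst := h.cont_fst.mono (Icc_subset_Icc ha hb)
  cont_snd := h.cont_snd.mono (Icc_subset_Icc ha hb)
  deriv_fst t ht := h.deriv_fst t (Ioo_subset_Ioo ha hb ht)
  deriv_snd t ht := h.deriv_snd t (Ioo_subset_Ioo ha hb ht)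
  nonneg t ht := h.nonneg t (Icc_subset_Icc ha hb ht)

theorem comp_sub (h : IsSystemSolution α a b X Y) (δ : ℝ) :
    IsSystemSolution α (a + δ) (b + δ) (fun t => X (t - δ)) (fun t => Y (t - δ)) where
  cont_fst := h.cont_fst.comp (by fun_prop)
    (fun t ht => ⟨by linarith [ht.1], by linarith [ht.2]⟩)
  cont_snd := h.cont_snd.comp (by fun_prop)
    (fun t ht => ⟨by linarith [ht.1], by linarith [ht.2]⟩)
  deriv_fst t ht := (h.deriv_fst (t - δ) ⟨by linarith [ht.1], by linarith [ht.2]⟩).comp_sub_const t δ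
  deriv_snd t ht := (h.deriv_snd (t - δ) ⟨by linarith [ht.1], by linarith [ht.2]⟩).comp_sub_const t δ
  nonneg t ht := h.nonneg (t - δ) ⟨by linarith [ht.1], by linarith [ht.2]⟩

theorem monotoneOn_snd (h : IsSystemSolution α a b X Y) : MonotoneOn Y (Icc a b) :=
  monotoneOn_Icc_of_hasDerivAt h.cont_snd h.deriv_snd fun t ht =>
    Real.rpow_nonneg (h.nonneg t (Ioo_subset_Icc_self ht)) _

/-- Integrating the system once sends a factor `l` to `l ^ α`, which is closer to `1`. The bound on
`Y` comes from integrating `X ^ α`, the bound on `X` from the integrating factor `exp t`. With `l =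
1` it transfers an inequality between the `X` to the `Y`. -/
theorem rpow_mul_le (hα : 0 ≤ α) (h₁ : IsSystemSolution α a b X₁ Y₁)
    (h₂ : IsSystemSolution α a b X₂ Y₂) (hX₁ : 0 ≤ X₁ a) (hY₁ : 0 ≤ Y₁ a) (hX₂ : X₂ a = 0)
    (hY₂ : Y₂ a = 0) {l : ℝ} (hl : 0 ≤ l) (hle : ∀ t ∈ Icc a b, l * X₂ t ≤ X₁ t) :
    ∀ t ∈ Icc a b, l ^ α * Y₂ t ≤ Y₁ t ∧ l ^ α * X₂ t ≤ X₁ t := by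
  have hY : ∀ t ∈ Icc a b, l ^ α * Y₂ t ≤ Y₁ t := by
    intro t ht
    have hm : MonotoneOn (fun t => Y₁ t - l ^ α * Y₂ t) (Icc a b) := by
      refine monotoneOn_Icc_of_hasDerivAt (f' := fun t => X₁ t ^ α - l ^ α * X₂ t ^ α)
        (h₁.cont_snd.sub (h₂.cont_snd.const_mul _))
        (fun t ht => (h₁.deriv_snd t ht).sub ((h₂.deriv_snd t ht).const_mul _)) ?_
      intro t ht
      have ht' := Ioo_subset_Icc_self ht
      rw [← Real.mul_rpow hl (h₂.nonneg t ht')]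
      exact sub_nonneg.2 (Real.rpow_le_rpow (mul_nonneg hl (h₂.nonneg t ht')) (hle t ht') hα)
    have := hm (left_mem_Icc.2 (ht.1.trans ht.2)) ht ht.1
    simp only [hY₂] at this
    linarith
  intro t ht
  refine ⟨hY t ht, ?_⟩
  have hm : MonotoneOn (fun t => Real.exp t * (X₁ t - l ^ α * X₂ t)) (Icc a b) := by
    refine monotoneOn_Icc_of_hasDerivAt (f' := fun t => Real.exp t * (Y₁ t - l ^ α * Y₂ t))
      (Real.continuous_exp.continuousOn.mul (h₁.cont_fst.sub (h₂.cont_fst.const_mul _)))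
      (fun t ht => ?_) ?_
    · refine ((Real.hasDerivAt_exp t).mul
        ((h₁.deriv_fst t ht).sub ((h₂.deriv_fst t ht).const_mul (l ^ α)))).congr_deriv ?_
      simp only [Pi.sub_apply]
      ring
    · intro t ht
      have := hY t (Ioo_subset_Icc_self ht)
      exact mul_nonneg (Real.exp_pos t).le (by linarith)
  have h := hm (left_mem_Icc.2 (ht.1.trans ht.2)) ht ht.1
  simp only [hX₂] at h
  have h' : 0 ≤ Real.exp t * (X₁ t - l ^ α * X₂ t) :=
    le_trans (mul_nonneg (Real.exp_pos a).le (by linarith)) h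
  linarith [nonneg_of_mul_nonneg_right h' (Real.exp_pos t)]

/-- Comparison principle: the nonlinearity `x ^ α` is not Lipschitz, but it is a contraction for the
multiplicative distance. -/
theorem le_of_pos (hα : 0 ≤ α) (hα₁ : α < 1) (h₁ : IsSystemSolution α a b X₁ Y₁)
    (h₂ : IsSystemSolution α a b X₂ Y₂) (hX₁ : ∀ t ∈ Icc a b, 0 < X₁ t) (hY₁ : 0 ≤ Y₁ a)
    (hX₂ : X₂ a = 0) (hY₂ : Y₂ a = 0) :
    ∀ t ∈ Icc a b, X₂ t ≤ X₁ t := by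
  intro t ht
  have hab : a ≤ b := ht.1.trans ht.2
  obtain ⟨s, hs, hmin⟩ := isCompact_Icc.exists_isMinOn (nonempty_Icc.2 hab) h₁.cont_fst
  obtain ⟨r, hr, hmax⟩ := isCompact_Icc.exists_isMaxOn (nonempty_Icc.2 hab) h₂.cont_fst
  have hr0 := h₂.nonneg r hr
  have hs0 := hX₁ s hs
  -- Minimum of `X₁` over maximum of `X₂`; the `+ 1` keeps the quotient defined when `X₂` vanishes
  -- identically.
  set l := X₁ s / (X₂ r + 1) with hl
  have hl0 : 0 < l := by positivity
  have hle : ∀ n : ℕ, ∀ t ∈ Icc a b, l ^ (α ^ n) * X₂ t ≤ X₁ t := by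
    intro n
    induction n with
    | zero =>
      intro t ht
      have e1 : X₁ s ≤ X₁ t := hmin ht
      have e2 : X₂ t ≤ X₂ r := hmax ht
      rw [pow_zero, Real.rpow_one]
      calc l * X₂ t ≤ l * (X₂ r + 1) := by gcongr; linarith
        _ = X₁ s := by rw [hl]; field_simp
        _ ≤ X₁ t := e1
    | succ n ih =>
      intro t ht
      have := (rpow_mul_le hα h₁ h₂ (hX₁ a (left_mem_Icc.2 hab)).le hY₁ hX₂ hY₂
        (Real.rpow_nonneg hl0.le _) ih t ht).2
      rwa [← Real.rpow_mul hl0.le, ← pow_succ] at this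
  -- As `α ^ n → 0`, the factors `l ^ (α ^ n)` tend to `1`, whatever the initial `l > 0`.
  have hlim : Filter.Tendsto (fun n : ℕ => l ^ (α ^ n) * X₂ t) Filter.atTop (nhds (1 * X₂ t)) := by
    refine Filter.Tendsto.mul_const _ ?_
    have := (Real.continuous_const_rpow hl0.ne').tendsto 0
    rw [Real.rpow_zero] at this
    exact this.comp (tendsto_pow_atTop_nhds_zero_of_lt_one hα hα₁)
  rw [one_mul] at hlim
  exact le_of_tendsto' hlim fun n => hle n t ht

theorem le_of_pos_of_zero (hα : 0 ≤ α) (hα₁ : α < 1) (h₁ : IsSystemSolution α 0 b X₁ Y₁)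
    (h₂ : IsSystemSolution α 0 b X₂ Y₂) (hX₁ : ∀ t ∈ Ioc 0 b, 0 < X₁ t) (hX₁0 : X₁ 0 = 0)
    (hY₁ : Y₁ 0 = 0) (hX₂ : X₂ 0 = 0) (hY₂ : Y₂ 0 = 0) :
    ∀ t ∈ Icc 0 b, X₂ t ≤ X₁ t := by
  intro t ht
  rcases ht.1.eq_or_lt with rfl | ht0
  · rw [hX₂, hX₁0]
  have hlim : Filter.Tendsto (fun δ => X₂ (t - δ)) (nhdsWithin 0 (Ioi 0)) (nhds (X₂ t)) := by
    have hc := h₂.cont_fst t ht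
    refine hc.tendsto.comp (tendsto_nhdsWithin_iff.2 ⟨?_, ?_⟩)
    · have : Filter.Tendsto (fun δ : ℝ => t - δ) (nhds 0) (nhds (t - 0)) :=
        (continuous_const.sub continuous_id).tendsto 0
      rw [sub_zero] at this
      exact this.mono_left nhdsWithin_le_nhds
    · filter_upwards [Ioo_mem_nhdsGT ht0] with δ hδ
      exact ⟨by linarith [hδ.2], by linarith [hδ.1, ht.2]⟩
  refine le_of_tendsto hlim ?_
  filter_upwards [Ioo_mem_nhdsGT ht0] with δ hδ
  have hb : (0 : ℝ) ≤ b := ht.1.trans ht.2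
  -- Delaying `X₂` by `δ` makes it start from zero at a time when `X₁` is already positive; then `δ
  -- → 0`.
  refine le_of_pos (a := δ) (b := b) hα hα₁ (h₁.mono hδ.1.le le_rfl)
    ((h₂.comp_sub δ).mono (by simp) (by linarith [hδ.1])) (fun s hs => hX₁ s ⟨hδ.1.trans_le hs.1, hs.2⟩)
    ?_ (by simp [hX₂]) (by simp [hY₂]) t ⟨hδ.2.le, ht.2⟩
  rw [← hY₁]
  exact h₁.monotoneOn_snd (left_mem_Icc.2 hb) ⟨hδ.1.le, hδ.2.le.trans ht.2⟩ hδ.1.le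

theorem eqOn_of_pos (hα : 0 ≤ α) (hα₁ : α < 1) (h₁ : IsSystemSolution α 0 b X₁ Y₁)
    (h₂ : IsSystemSolution α 0 b X₂ Y₂) (hX₁ : ∀ t ∈ Ioc 0 b, 0 < X₁ t)
    (hX₂ : ∀ t ∈ Ioc 0 b, 0 < X₂ t) (hX₁0 : X₁ 0 = 0)
    (hY₁ : Y₁ 0 = 0) (hX₂0 : X₂ 0 = 0) (hY₂ : Y₂ 0 = 0) :
    ∀ t ∈ Icc 0 b, X₁ t = X₂ t ∧ Y₁ t = Y₂ t := by
  intro t ht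
  have e : ∀ t ∈ Icc 0 b, X₁ t = X₂ t := fun t ht =>
    le_antisymm (le_of_pos_of_zero hα hα₁ h₂ h₁ hX₂ hX₂0 hY₂ hX₁0 hY₁ t ht)
      (le_of_pos_of_zero hα hα₁ h₁ h₂ hX₁ hX₁0 hY₁ hX₂0 hY₂ t ht)
  refine ⟨e t ht, le_antisymm ?_ ?_⟩
  · have := (rpow_mul_le hα h₂ h₁ hX₂0.ge hY₂.ge hX₁0 hY₁ zero_le_one
      (fun s hs => by rw [one_mul, e s hs]) t ht).1
    rwa [Real.one_rpow, one_mul] at this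
  · have := (rpow_mul_le hα h₁ h₂ hX₁0.ge hY₁.ge hX₂0 hY₂ zero_le_one
      (fun s hs => by rw [one_mul, e s hs]) t ht).1
    rwa [Real.one_rpow, one_mul] at this

end IsSystemSolution

end CombustionWave

/-! ### Construction of the universal profile by monotone iteration. -/

namespace CombustionWave

/-- `(U, F)` is the universal profile: `U'' + U' = U ^ α` with `F = U + U'`, `U = 0` on `(-∞, 0]` and
`U > 0` on `(0, ∞)`, growing at `0` like `t ^ (2 / (1 - α))`. -/
structure IsUniversalProfile (α : ℝ) (U F : ℝ → ℝ) : Prop where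
  deriv_fst : ∀ t, HasDerivAt U (F t - U t) t
  deriv_snd : ∀ t, HasDerivAt F (U t ^ α) t
  fst_eq_zero : ∀ t ≤ 0, U t = 0
  snd_eq_zero : ∀ t ≤ 0, F t = 0
  le_rpow : ∀ t, 0 ≤ t → U t ≤ t ^ (2 / (1 - α))
  exists_rpow_le : ∀ T, 0 < T → ∃ a, 0 < a ∧ ∀ t ∈ Icc 0 T, a * t ^ (2 / (1 - α)) ≤ U t

section Iteration

variable {α : ℝ} {f g : ℝ → ℝ}

noncomputable def iterSnd (α : ℝ) (f : ℝ → ℝ) (t : ℝ) : ℝ := ∫ s in (0 : ℝ)..t, f s ^ α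

/-- Duhamel's formula for `y' = g - y`, `y(0) = 0`. -/
noncomputable def expAverage (g : ℝ → ℝ) (t : ℝ) : ℝ := Real.exp (-t) * ∫ s in (0 : ℝ)..t, Real.exp s * g s

/-- The exponent `m = 2 / (1 - α)` satisfies `m α = m - 2`, so it balances `U''` against `U ^ α`.
The starting power is a supersolution. -/
noncomputable def profileIter (α : ℝ) : ℕ → ℝ → ℝ
  | 0 => fun t => max t 0 ^ (2 / (1 - α))
  | n + 1 => expAverage (iterSnd α (profileIter α n))

theorem hasDerivAt_iterSnd (hα : 0 ≤ α) (hf : Continuous f) (t : ℝ) :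
    HasDerivAt (iterSnd α f) (f t ^ α) t :=
  ((hf.rpow_const fun _ => Or.inr hα).integral_hasStrictDerivAt 0 t).hasDerivAt

theorem hasDerivAt_expAverage (hg : Continuous g) (t : ℝ) :
    HasDerivAt (expAverage g) (g t - expAverage g t) t := by
  have h1 : HasDerivAt (fun t : ℝ => Real.exp (-t)) (-Real.exp (-t)) t := by
    exact (hasDerivAt_neg t).exp.congr_deriv (by ring)
  have h2 := ((Real.continuous_exp.mul hg).integral_hasStrictDerivAt 0 t).hasDerivAt
  refine (h1.mul h2).congr_deriv ?_
  have : Real.exp (-t) * Real.exp t = 1 := by rw [← Real.exp_add]; simp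
  simp only [expAverage, Pi.mul_apply]
  linear_combination g t * this

theorem continuous_iterSnd (hα : 0 ≤ α) (hf : Continuous f) : Continuous (iterSnd α f) :=
  continuous_iff_continuousAt.2 fun t => (hasDerivAt_iterSnd hα hf t).continuousAt

theorem continuous_expAverage (hg : Continuous g) : Continuous (expAverage g) :=
  continuous_iff_continuousAt.2 fun t => (hasDerivAt_expAverage hg t).continuousAt

theorem iterSnd_eq_zero (hα : 0 < α) (hf : ∀ t ≤ 0, f t = 0) : ∀ t ≤ 0, iterSnd α f t = 0 := by
  intro t ht
  refine (intervalIntegral.integral_congr (g := fun _ => (0 : ℝ)) fun s hs => ?_).trans (by simp)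
  rw [uIcc_of_ge ht] at hs
  simp [hf s hs.2, Real.zero_rpow hα.ne']

theorem expAverage_eq_zero (hg : ∀ t ≤ 0, g t = 0) : ∀ t ≤ 0, expAverage g t = 0 := by
  intro t ht
  have : ∫ s in (0 : ℝ)..t, Real.exp s * g s = 0 := by
    refine (intervalIntegral.integral_congr (g := fun _ => (0 : ℝ)) fun s hs => ?_).trans (by simp)
    rw [uIcc_of_ge ht] at hs
    simp [hg s hs.2]
  simp [expAverage, this]

theorem iterSnd_mono (hα : 0 ≤ α) (hf : Continuous f) (hg : Continuous g) (hf0 : ∀ t, 0 ≤ f t)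
    (hfg : ∀ t, f t ≤ g t) {t : ℝ} (ht : 0 ≤ t) : iterSnd α f t ≤ iterSnd α g t :=
  intervalIntegral.integral_mono_on ht
    ((hf.rpow_const fun _ => Or.inr hα).intervalIntegrable _ _)
    ((hg.rpow_const fun _ => Or.inr hα).intervalIntegrable _ _)
    fun s _ => Real.rpow_le_rpow (hf0 s) (hfg s) hα

theorem expAverage_mono (hf : Continuous f) (hg : Continuous g) (hfg : ∀ t, 0 ≤ t → f t ≤ g t)
    {t : ℝ} (ht : 0 ≤ t) : expAverage f t ≤ expAverage g t := by
  refine mul_le_mul_of_nonneg_left ?_ (Real.exp_pos _).le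
  exact intervalIntegral.integral_mono_on ht
    ((Real.continuous_exp.mul hf).intervalIntegrable _ _)
    ((Real.continuous_exp.mul hg).intervalIntegrable _ _)
    fun s hs => mul_le_mul_of_nonneg_left (hfg s hs.1) (Real.exp_pos _).le

theorem iterSnd_nonneg (hf0 : ∀ t, 0 ≤ f t) {t : ℝ} (ht : 0 ≤ t) : 0 ≤ iterSnd α f t :=
  intervalIntegral.integral_nonneg ht fun s _ => Real.rpow_nonneg (hf0 s) _

theorem expAverage_nonneg (hg : ∀ t, 0 ≤ t → 0 ≤ g t) {t : ℝ} (ht : 0 ≤ t) : 0 ≤ expAverage g t :=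
  mul_nonneg (Real.exp_pos _).le <| intervalIntegral.integral_nonneg ht fun s hs =>
    mul_nonneg (Real.exp_pos _).le (hg s hs.1)

theorem two_le_two_div (hα : 0 < α) (hα₁ : α < 1) : 2 < 2 / (1 - α) := by
  rw [lt_div_iff₀ (by linarith)]; linarith

theorem two_div_mul (hα₁ : α < 1) : 2 / (1 - α) * α = 2 / (1 - α) - 2 := by
  have : 1 - α ≠ 0 := by linarith
  field_simp; ring

theorem profileIter_basic (hα : 0 < α) (hα₁ : α < 1) (n : ℕ) :
    Continuous (profileIter α n) ∧ (∀ t, 0 ≤ profileIter α n t) ∧ ∀ t ≤ 0, profileIter α n t = 0 := by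
  have hm := two_le_two_div hα hα₁
  induction n with
  | zero =>
    refine ⟨(continuous_id.max continuous_const).rpow_const fun _ => Or.inr (by linarith),
      fun t => Real.rpow_nonneg (le_max_right _ _) _, fun t ht => ?_⟩
    simp only [profileIter]
    rw [max_eq_right ht, Real.zero_rpow (by linarith)]
  | succ n ih =>
    obtain ⟨h1, h2, h3⟩ := ih
    have h4 := expAverage_eq_zero (iterSnd_eq_zero hα h3)
    refine ⟨continuous_expAverage (continuous_iterSnd hα.le h1), fun t => ?_, h4⟩
    rcases le_total t 0 with ht | ht
    · exact (h4 t ht).ge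
    · exact expAverage_nonneg (fun s hs => iterSnd_nonneg h2 hs) ht

theorem profileIter_zero_rpow (hα₁ : α < 1) {t : ℝ} (ht : 0 ≤ t) :
    profileIter α 0 t ^ α = t ^ (2 / (1 - α) - 2) := by
  simp only [profileIter]
  rw [max_eq_left ht, ← Real.rpow_mul ht, two_div_mul hα₁]

/-- Each integrand is bounded by its value at the right end: two integrations contribute the factor
`t ^ 2` lost in passing from `t ^ m` to `t ^ (m - 2)`, and the exponentials cancel. -/
theorem profileIter_one_le (hα : 0 < α) (hα₁ : α < 1) (t : ℝ) :
    profileIter α 1 t ≤ profileIter α 0 t := by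
  have hm := two_le_two_div hα hα₁
  obtain ⟨c0, -, z0⟩ := profileIter_basic hα hα₁ 0
  obtain ⟨-, -, z1⟩ := profileIter_basic hα hα₁ 1
  rcases le_or_gt t 0 with ht | ht
  · rw [z0 t ht, z1 t ht]
  set m := 2 / (1 - α) with hmdef
  have hF : ∀ s ∈ Icc 0 t, iterSnd α (profileIter α 0) s ≤ t ^ (m - 1) := by
    intro s hs
    calc iterSnd α (profileIter α 0) s ≤ ∫ r in (0 : ℝ)..s, t ^ (m - 2) := by
          refine intervalIntegral.integral_mono_on hs.1
            ((c0.rpow_const fun _ => Or.inr hα.le).intervalIntegrable _ _) (by simp) fun r hr => ?_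
          rw [profileIter_zero_rpow hα₁ hr.1]
          exact Real.rpow_le_rpow hr.1 (hr.2.trans hs.2) (by linarith)
      _ = s * t ^ (m - 2) := by simp
      _ ≤ t * t ^ (m - 2) := by gcongr; exact hs.2
      _ = t ^ (m - 1) := by
        rw [← Real.rpow_one_add' ht.le (by linarith)]; congr 1; ring
  have hI : ∫ s in (0 : ℝ)..t, Real.exp s * iterSnd α (profileIter α 0) s ≤
      ∫ s in (0 : ℝ)..t, Real.exp t * t ^ (m - 1) := by
    refine intervalIntegral.integral_mono_on ht.le
      ((Real.continuous_exp.mul (continuous_iterSnd hα.le c0)).intervalIntegrable _ _) (by simp)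
      fun s hs => ?_
    exact mul_le_mul (Real.exp_le_exp.2 hs.2) (hF s hs)
      (iterSnd_nonneg (profileIter_basic hα hα₁ 0).2.1 hs.1) (Real.exp_pos _).le
  calc profileIter α 1 t ≤ Real.exp (-t) * ∫ s in (0 : ℝ)..t, Real.exp t * t ^ (m - 1) :=
        mul_le_mul_of_nonneg_left hI (Real.exp_pos _).le
    _ = (Real.exp (-t) * Real.exp t) * (t * t ^ (m - 1)) := by simp; ring
    _ = t ^ m := by
      rw [← Real.exp_add, ← Real.rpow_one_add' ht.le (by linarith)]; simp
    _ = profileIter α 0 t := by simp only [profileIter]; rw [max_eq_left ht.le]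

theorem profileIter_succ_le (hα : 0 < α) (hα₁ : α < 1) (n : ℕ) (t : ℝ) :
    profileIter α (n + 1) t ≤ profileIter α n t := by
  induction n generalizing t with
  | zero => exact profileIter_one_le hα hα₁ t
  | succ n ih =>
    obtain ⟨c0, p0, -⟩ := profileIter_basic hα hα₁ n
    obtain ⟨c1, p1, z1⟩ := profileIter_basic hα hα₁ (n + 1)
    obtain ⟨-, -, z2⟩ := profileIter_basic hα hα₁ (n + 2)
    rcases le_total t 0 with ht | ht
    · rw [z1 t ht, z2 t ht]
    · exact expAverage_mono (continuous_iterSnd hα.le c1) (continuous_iterSnd hα.le c0)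
        (fun s hs => iterSnd_mono hα.le c1 c0 p1 ih hs) ht

theorem profileIter_antitone (hα : 0 < α) (hα₁ : α < 1) (t : ℝ) :
    Antitone fun n => profileIter α n t :=
  antitone_nat_of_succ_le fun n => profileIter_succ_le hα hα₁ n t

/-- One step of the iteration preserves the lower barrier `a t ^ m`. Integrating `(a t ^ m) ^ α`
gives `a ^ α t ^ (m - 1) / (m - 1)`, and the barrier needs this to dominate its value plus its
derivative, `a (t + m) t ^ (m - 1)`. As `α < 1`, this holds for small `a`. -/
theorem mul_rpow_le_expAverage_iterSnd (hα : 0 < α) (hα₁ : α < 1) {a T : ℝ} (ha : 0 < a)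
    (haT : a ^ (1 - α) * ((T + 2 / (1 - α)) * (2 / (1 - α) - 1)) ≤ 1) (hf : Continuous f)
    (h : ∀ t ∈ Icc 0 T, a * t ^ (2 / (1 - α)) ≤ f t) :
    ∀ t ∈ Icc 0 T, a * t ^ (2 / (1 - α)) ≤ expAverage (iterSnd α f) t := by
  have hm := two_le_two_div hα hα₁
  have hmα := two_div_mul hα₁
  set m := 2 / (1 - α) with hmdef
  have hF : ∀ t ∈ Icc 0 T, a ^ α * t ^ (m - 1) / (m - 1) ≤ iterSnd α f t := by
    intro t ht
    have hmono : MonotoneOn (fun t => iterSnd α f t - a ^ α / (m - 1) * t ^ (m - 1)) (Icc 0 T) := by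
      refine monotoneOn_Icc_of_hasDerivAt (f' := fun t => f t ^ α - a ^ α * t ^ (m - 2)) ?_ ?_ ?_
      · exact ((continuous_iterSnd hα.le hf).sub (continuous_const.mul
          (continuous_id.rpow_const fun _ => Or.inr (by linarith)))).continuousOn
      · intro t ht
        refine ((hasDerivAt_iterSnd hα.le hf t).sub
          ((Real.hasDerivAt_rpow_const (p := m - 1) (Or.inl ht.1.ne')).const_mul _)).congr_deriv ?_
        have : m - 1 ≠ 0 := by linarith
        field_simp
        ring_nf
      · intro t ht
        have e : a ^ α * t ^ (m - 2) = (a * t ^ m) ^ α := by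
          rw [Real.mul_rpow ha.le (Real.rpow_nonneg ht.1.le _), ← Real.rpow_mul ht.1.le, hmα]
        rw [e]
        exact sub_nonneg.2 (Real.rpow_le_rpow
          (mul_nonneg ha.le (Real.rpow_nonneg ht.1.le _)) (h t (Ioo_subset_Icc_self ht)) hα.le)
    have h0 := hmono (left_mem_Icc.2 (ht.1.trans ht.2)) ht ht.1
    have hz : iterSnd α f 0 = 0 := by simp [iterSnd]
    simp only [hz, Real.zero_rpow (show m - 1 ≠ 0 by linarith)] at h0
    have : a ^ α * t ^ (m - 1) / (m - 1) = a ^ α / (m - 1) * t ^ (m - 1) := by ring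
    linarith
  intro t ht
  have hc := continuous_iterSnd hα.le hf
  have hmono : MonotoneOn (fun t => Real.exp t * (expAverage (iterSnd α f) t - a * t ^ m))
      (Icc 0 T) := by
    refine monotoneOn_Icc_of_hasDerivAt
      (f' := fun t => Real.exp t * (iterSnd α f t - a * t ^ m - a * (m * t ^ (m - 1)))) ?_ ?_ ?_
    · exact (Real.continuous_exp.mul ((continuous_expAverage hc).sub (continuous_const.mul
        (continuous_id.rpow_const fun _ => Or.inr (by linarith))))).continuousOn
    · intro t ht
      refine ((Real.hasDerivAt_exp t).mul ((hasDerivAt_expAverage hc t).sub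
        ((Real.hasDerivAt_rpow_const (p := m) (Or.inl ht.1.ne')).const_mul a))).congr_deriv ?_
      simp only [Pi.sub_apply]
      ring
    · intro t ht
      refine mul_nonneg (Real.exp_pos t).le ?_
      have hF' := hF t (Ioo_subset_Icc_self ht)
      have e1 : t ^ m = t * t ^ (m - 1) := by
        rw [← Real.rpow_one_add' ht.1.le (by linarith)]; congr 1; ring
      have e2 : a = a ^ α * a ^ (1 - α) := by
        rw [← Real.rpow_add ha]; simp
      have hp : 0 ≤ t ^ (m - 1) := Real.rpow_nonneg ht.1.le _
      have hq : 0 ≤ a ^ α := Real.rpow_nonneg ha.le _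
      have hr : 0 ≤ a ^ (1 - α) := Real.rpow_nonneg ha.le _
      have hm1 : 0 < m - 1 := by linarith
      have e3 : a ^ (1 - α) * (t + m) ≤ 1 / (m - 1) := by
        rw [le_div_iff₀ hm1]
        refine le_trans ?_ haT
        rw [mul_assoc]
        gcongr
        exact ht.2.le
      have e4 : a * t ^ m + a * (m * t ^ (m - 1)) ≤ a ^ α * t ^ (m - 1) / (m - 1) := by
        calc a * t ^ m + a * (m * t ^ (m - 1)) = a * ((t + m) * t ^ (m - 1)) := by rw [e1]; ring
          _ = a ^ α * t ^ (m - 1) * (a ^ (1 - α) * (t + m)) := by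
            nth_rewrite 1 [e2]; ring
          _ ≤ a ^ α * t ^ (m - 1) * (1 / (m - 1)) := by gcongr
          _ = _ := by ring
      linarith
  have h0 := hmono (left_mem_Icc.2 (ht.1.trans ht.2)) ht ht.1
  have hz : expAverage (iterSnd α f) 0 = 0 := by simp [expAverage]
  simp only [hz, Real.zero_rpow (show m ≠ 0 by linarith)] at h0
  have h0' : 0 ≤ Real.exp t * (expAverage (iterSnd α f) t - a * t ^ m) := by simpa using h0
  linarith [nonneg_of_mul_nonneg_right h0' (Real.exp_pos t)]

theorem exists_mul_rpow_le_profileIter (hα : 0 < α) (hα₁ : α < 1) {T : ℝ} (hT : 0 < T) :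
    ∃ a, 0 < a ∧ ∀ n, ∀ t ∈ Icc 0 T, a * t ^ (2 / (1 - α)) ≤ profileIter α n t := by
  have hm := two_le_two_div hα hα₁
  have h1α : 0 < 1 - α := by linarith
  set B := (T + 2 / (1 - α)) * (2 / (1 - α) - 1) with hB
  have hB1 : 1 ≤ B := by nlinarith
  have hB0 : 0 < B := by linarith
  -- This `a` solves `a ^ (1 - α) * B = 1`, the equality case of the barrier condition.
  refine ⟨(B⁻¹) ^ (1 / (1 - α)), by positivity, fun n => ?_⟩
  have e : ((B⁻¹) ^ (1 / (1 - α))) ^ (1 - α) * B ≤ 1 := by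
    rw [← Real.rpow_mul (by positivity), one_div_mul_cancel h1α.ne', Real.rpow_one,
      inv_mul_cancel₀ hB0.ne']
  induction n with
  | zero =>
    intro t ht
    simp only [profileIter]
    rw [max_eq_left ht.1]
    refine mul_le_of_le_one_left (Real.rpow_nonneg ht.1 _) ?_
    exact Real.rpow_le_one (by positivity) (inv_le_one_of_one_le₀ hB1) (by positivity)
  | succ n ih =>
    exact mul_rpow_le_expAverage_iterSnd hα hα₁ (by positivity) e
      (profileIter_basic hα hα₁ n).1 ih

/-- The iterates decrease, and the barrier keeps their limit from collapsing to the zero solution.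
-/
theorem exists_isUniversalProfile (hα : 0 < α) (hα₁ : α < 1) :
    ∃ U F : ℝ → ℝ, IsUniversalProfile α U F := by
  have hb := profileIter_basic hα hα₁
  have hanti := profileIter_antitone hα hα₁
  have hbdd : ∀ t, BddBelow (range fun n => profileIter α n t) := fun t =>
    ⟨0, by rintro _ ⟨n, rfl⟩; exact (hb n).2.1 t⟩
  set U : ℝ → ℝ := fun t => ⨅ n, profileIter α n t with hU
  have hlim : ∀ t, Filter.Tendsto (fun n => profileIter α n t) Filter.atTop (nhds (U t)) :=
    fun t => tendsto_atTop_ciInf (hanti t) (hbdd t)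
  have hle : ∀ n t, U t ≤ profileIter α n t := fun n t => ciInf_le (hbdd t) n
  have hU0 : ∀ t, 0 ≤ U t := fun t => le_ciInf fun n => (hb n).2.1 t
  have hUz : ∀ t ≤ 0, U t = 0 := fun t ht =>
    le_antisymm ((hle 0 t).trans ((hb 0).2.2 t ht).le) (hU0 t)
  -- An infimum of continuous functions need not be continuous; measurability and domination carry
  -- the limit until the fixed point identity `hfix` gives differentiability.
  have hUm : Measurable U := measurable_of_tendsto_metrizable (fun n => (hb n).1.measurable)
    (tendsto_pi_nhds.2 hlim)
  have c0 : Continuous fun t => profileIter α 0 t ^ α := (hb 0).1.rpow_const fun _ => Or.inr hα.le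
  have hint : ∀ a b, IntervalIntegrable (fun t => U t ^ α) MeasureTheory.volume a b := by
    intro a b
    refine (c0.intervalIntegrable a b).mono_fun (hUm.pow_const α).aestronglyMeasurable ?_
    refine Filter.Eventually.of_forall fun t => ?_
    beta_reduce
    rw [Real.norm_of_nonneg (Real.rpow_nonneg (hU0 t) _),
      Real.norm_of_nonneg (Real.rpow_nonneg ((hb 0).2.1 t) _)]
    exact Real.rpow_le_rpow (hU0 t) (hle 0 t) hα.le
  have hFc : Continuous (iterSnd α U) := intervalIntegral.continuous_primitive hint 0
  have hFlim : ∀ t, Filter.Tendsto (fun n => iterSnd α (profileIter α n) t) Filter.atTop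
      (nhds (iterSnd α U t)) := by
    intro t
    refine intervalIntegral.tendsto_integral_filter_of_dominated_convergence
      (fun t => profileIter α 0 t ^ α) ?_ ?_ (c0.intervalIntegrable _ _) ?_
    · exact Filter.Eventually.of_forall fun n =>
        ((hb n).1.rpow_const fun _ => Or.inr hα.le).aestronglyMeasurable
    · refine Filter.Eventually.of_forall fun n => Filter.Eventually.of_forall fun s _ => ?_
      rw [Real.norm_of_nonneg (Real.rpow_nonneg ((hb n).2.1 s) _)]
      exact Real.rpow_le_rpow ((hb n).2.1 s) (hanti s (Nat.zero_le n)) hα.le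
    · exact Filter.Eventually.of_forall fun s _ =>
        ((Real.continuousAt_rpow_const _ _ (Or.inr hα.le)).tendsto.comp (hlim s))
  have hUlim : ∀ t, 0 ≤ t → Filter.Tendsto (fun n => profileIter α (n + 1) t) Filter.atTop
      (nhds (expAverage (iterSnd α U) t)) := by
    intro t ht
    have hc : ∀ n, Continuous fun s => Real.exp s * iterSnd α (profileIter α n) s := fun n =>
      Real.continuous_exp.mul (continuous_iterSnd hα.le (hb n).1)
    refine Filter.Tendsto.const_mul _ ?_
    refine intervalIntegral.tendsto_integral_filter_of_dominated_convergence
      (fun s => Real.exp s * iterSnd α (profileIter α 0) s) ?_ ?_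
      ((hc 0).intervalIntegrable _ _) ?_
    · exact Filter.Eventually.of_forall fun n => (hc n).aestronglyMeasurable
    · refine Filter.Eventually.of_forall fun n => Filter.Eventually.of_forall fun s hs => ?_
      rw [uIoc_of_le ht] at hs
      rw [Real.norm_of_nonneg (mul_nonneg (Real.exp_pos s).le (iterSnd_nonneg (hb n).2.1 hs.1.le))]
      exact mul_le_mul_of_nonneg_left (iterSnd_mono hα.le (hb n).1 (hb 0).1 (hb n).2.1
        (fun r => hanti r (Nat.zero_le n)) hs.1.le) (Real.exp_pos s).le
    · exact Filter.Eventually.of_forall fun s _ => (hFlim s).const_mul _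
  have hfix : U = expAverage (iterSnd α U) := by
    funext t
    rcases le_total t 0 with ht | ht
    · rw [hUz t ht, expAverage_eq_zero (iterSnd_eq_zero hα hUz) t ht]
    · exact tendsto_nhds_unique ((Filter.tendsto_add_atTop_iff_nat 1).2 (hlim t)) (hUlim t ht)
  have hUd : ∀ t, HasDerivAt U (iterSnd α U t - U t) t := by
    intro t
    have := hasDerivAt_expAverage hFc t
    rwa [← hfix] at this
  have hUc : Continuous U := continuous_iff_continuousAt.2 fun t => (hUd t).continuousAt
  refine ⟨U, iterSnd α U, hUd, hasDerivAt_iterSnd hα.le hUc, hUz, iterSnd_eq_zero hα hUz, ?_, ?_⟩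
  · intro t ht
    refine (hle 0 t).trans_eq ?_
    simp only [profileIter]
    rw [max_eq_left ht]
  · intro T hT
    obtain ⟨a, ha, h⟩ := exists_mul_rpow_le_profileIter hα hα₁ hT
    exact ⟨a, ha, fun t ht => le_ciInf fun n => h n t ht⟩

end Iteration

end CombustionWave

/-! ### The ratio `U / F` as a bijection onto `(0, 1)`. -/

namespace CombustionWave

theorem strictMonoOn_Ici_of_hasDerivAt {f f' : ℝ → ℝ} {a : ℝ}
    (hd : ∀ t, a < t → HasDerivAt f (f' t) t) (hc : ContinuousWithinAt f (Ici a) a)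
    (h0 : ∀ t, a < t → 0 < f' t) : StrictMonoOn f (Ici a) := by
  refine strictMonoOn_of_deriv_pos (convex_Ici a) ?_ ?_
  · intro t ht
    rcases (mem_Ici.1 ht).eq_or_lt with rfl | h
    · exact hc
    · exact (hd t h).continuousAt.continuousWithinAt
  · rw [interior_Ici]
    intro t ht
    rw [(hd t ht).deriv]
    exact h0 t ht

namespace IsUniversalProfile

variable {α : ℝ} {U F : ℝ → ℝ}

theorem continuous_fst (h : IsUniversalProfile α U F) : Continuous U :=
  continuous_iff_continuousAt.2 fun t => (h.deriv_fst t).continuousAt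

theorem continuous_snd (h : IsUniversalProfile α U F) : Continuous F :=
  continuous_iff_continuousAt.2 fun t => (h.deriv_snd t).continuousAt

theorem fst_pos (h : IsUniversalProfile α U F) {t : ℝ} (ht : 0 < t) : 0 < U t := by
  obtain ⟨a, ha, hle⟩ := h.exists_rpow_le t ht
  exact (mul_pos ha (Real.rpow_pos_of_pos ht _)).trans_le (hle t ⟨ht.le, le_rfl⟩)

theorem fst_nonneg (h : IsUniversalProfile α U F) (t : ℝ) : 0 ≤ U t := by
  rcases le_or_gt t 0 with ht | ht
  · exact (h.fst_eq_zero t ht).ge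
  · exact (h.fst_pos ht).le

theorem isSystemSolution (h : IsUniversalProfile α U F) (a b : ℝ) :
    IsSystemSolution α a b U F where
  cont_fst := h.continuous_fst.continuousOn
  cont_snd := h.continuous_snd.continuousOn
  deriv_fst t _ := h.deriv_fst t
  deriv_snd t _ := h.deriv_snd t
  nonneg t _ := h.fst_nonneg t

/-- Since `F - U = U'`, this is `U' > 0`, which follows from `(exp t * U')' = exp t * U ^ α`. -/
theorem fst_lt_snd (h : IsUniversalProfile α U F) {t : ℝ} (ht : 0 < t) : U t < F t := by
  have hm : StrictMonoOn (fun t => Real.exp t * (F t - U t)) (Ici 0) := by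
    refine strictMonoOn_Ici_of_hasDerivAt (f' := fun t => Real.exp t * U t ^ α) ?_ ?_ ?_
    · intro t _
      refine ((Real.hasDerivAt_exp t).mul ((h.deriv_snd t).sub (h.deriv_fst t))).congr_deriv ?_
      simp only [Pi.sub_apply]
      ring
    · exact (Real.continuous_exp.mul
        (h.continuous_snd.sub h.continuous_fst)).continuousAt.continuousWithinAt
    · exact fun t ht => mul_pos (Real.exp_pos t) (Real.rpow_pos_of_pos (h.fst_pos ht) _)
  have := hm (mem_Ici.2 le_rfl) (mem_Ici.2 ht.le) ht
  simp only [h.fst_eq_zero 0 le_rfl, h.snd_eq_zero 0 le_rfl, sub_zero, mul_zero] at this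
  linarith [pos_of_mul_pos_right this (Real.exp_pos t).le]

theorem snd_pos (h : IsUniversalProfile α U F) {t : ℝ} (ht : 0 < t) : 0 < F t :=
  (h.fst_pos ht).trans (h.fst_lt_snd ht)

theorem fst_le_mul_snd (h : IsUniversalProfile α U F) {t : ℝ} (ht : 0 ≤ t) : U t ≤ t * F t := by
  have hm : MonotoneOn (fun t => t * F t - U t) (Icc 0 t) := by
    refine monotoneOn_Icc_of_hasDerivAt (f' := fun t => t * U t ^ α + U t) ?_ ?_ ?_
    · exact ((continuous_id.mul h.continuous_snd).sub h.continuous_fst).continuousOn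
    · intro t _
      refine (((hasDerivAt_id t).mul (h.deriv_snd t)).sub (h.deriv_fst t)).congr_deriv ?_
      simp only [id]
      ring
    · exact fun t ht => add_nonneg (mul_nonneg ht.1.le (Real.rpow_nonneg (h.fst_nonneg t) _))
        (h.fst_nonneg t)
  have := hm (left_mem_Icc.2 ht) (right_mem_Icc.2 ht) ht
  simp only [h.fst_eq_zero 0 le_rfl] at this
  linarith

/-- The difference of the two sides is `W = U' F - U F'`, the numerator of `(U / F)'`. It vanishes
at `0` and satisfies `W' + W = (1 - α) U ^ α U' > 0`. -/
theorem rpow_lt_mul (h : IsUniversalProfile α U F) (hα : 0 < α) (hα₁ : α < 1) {t : ℝ}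
    (ht : 0 < t) : U t * U t ^ α < (F t - U t) * F t := by
  have hm : StrictMonoOn (fun t => Real.exp t * ((F t - U t) * F t - U t * U t ^ α)) (Ici 0) := by
    refine strictMonoOn_Ici_of_hasDerivAt
      (f' := fun t => Real.exp t * ((1 - α) * U t ^ α * (F t - U t))) ?_ ?_ ?_
    · intro t ht
      have hU := h.fst_pos ht
      have e : U t * U t ^ (α - 1) = U t ^ α := by
        rw [← Real.rpow_one_add' hU.le (by linarith)]; congr 1; ring
      refine ((Real.hasDerivAt_exp t).mul ((((h.deriv_snd t).sub (h.deriv_fst t)).mul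
        (h.deriv_snd t)).sub ((h.deriv_fst t).mul
        ((h.deriv_fst t).rpow_const (p := α) (Or.inl hU.ne'))))).congr_deriv ?_
      simp only [Pi.sub_apply, Pi.mul_apply]
      linear_combination (-Real.exp t * α * (F t - U t)) * e
    · exact (Real.continuous_exp.mul (((h.continuous_snd.sub h.continuous_fst).mul
        h.continuous_snd).sub (h.continuous_fst.mul (h.continuous_fst.rpow_const
        fun _ => Or.inr hα.le)))).continuousAt.continuousWithinAt
    · exact fun t ht => mul_pos (Real.exp_pos t) (mul_pos (mul_pos (by linarith)
        (Real.rpow_pos_of_pos (h.fst_pos ht) _)) (sub_pos.2 (h.fst_lt_snd ht)))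
  have := hm (mem_Ici.2 le_rfl) (mem_Ici.2 ht.le) ht
  simp only [h.fst_eq_zero 0 le_rfl, h.snd_eq_zero 0 le_rfl, sub_zero, mul_zero, zero_mul] at this
  linarith [pos_of_mul_pos_right this (Real.exp_pos t).le]

theorem ratio_strictMonoOn (h : IsUniversalProfile α U F) (hα : 0 < α) (hα₁ : α < 1) :
    StrictMonoOn (fun t => U t / F t) (Ioi 0) := by
  have hd : ∀ t, 0 < t → HasDerivAt (fun t => U t / F t)
      (((F t - U t) * F t - U t * U t ^ α) / F t ^ 2) t := fun t ht =>
    (h.deriv_fst t).div (h.deriv_snd t) (h.snd_pos ht).ne'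
  refine strictMonoOn_of_deriv_pos (convex_Ioi 0)
    (fun t ht => (hd t ht).continuousAt.continuousWithinAt) ?_
  rw [interior_Ioi]
  intro t ht
  rw [(hd t ht).deriv]
  exact div_pos (sub_pos.2 (h.rpow_lt_mul hα hα₁ ht)) (pow_pos (h.snd_pos ht) 2)

theorem ratio_continuousOn (h : IsUniversalProfile α U F) :
    ContinuousOn (fun t => U t / F t) (Ioi 0) :=
  h.continuous_fst.continuousOn.div h.continuous_snd.continuousOn fun _ ht => (h.snd_pos ht).ne'

/-- If `U / F` stayed below `g < 1`, then `U' ≥ ε U` with `ε = 1 / g - 1`, so `U` would grow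
exponentially, against the polynomial bound `le_rpow`. -/
theorem exists_lt_ratio (h : IsUniversalProfile α U F) {g : ℝ} (hg : 0 < g)
    (hg₁ : g < 1) : ∃ t, 0 < t ∧ g ≤ U t / F t := by
  by_contra! hcon
  set ε := 1 / g - 1 with hε
  have hε0 : 0 < ε := by
    have := (one_lt_div hg).2 hg₁
    linarith
  have hgrow : ∀ t, 0 < t → 0 ≤ F t - U t - ε * U t := by
    intro t ht
    have h1 := hcon t ht
    rw [div_lt_iff₀ (h.snd_pos ht), ← div_lt_iff₀' hg] at h1
    have : F t - U t - ε * U t = F t - U t / g := by rw [hε]; ring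
    linarith
  have hle : ∀ t, 1 ≤ t → Real.exp (-ε * 1) * U 1 ≤ Real.exp (-ε * t) * U t := by
    intro t ht
    have hm : MonotoneOn (fun t => Real.exp (-ε * t) * U t) (Icc 1 t) := by
      refine monotoneOn_Icc_of_hasDerivAt
        (f' := fun t => Real.exp (-ε * t) * (F t - U t - ε * U t)) ?_ ?_ ?_
      · have := h.continuous_fst
        fun_prop
      · intro t _
        refine ((((hasDerivAt_id t).const_mul (-ε)).exp).mul (h.deriv_fst t)).congr_deriv ?_
        simp only [id]
        ring
      · exact fun t ht => mul_nonneg (Real.exp_pos _).le (hgrow t (by linarith [ht.1]))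
    exact hm (left_mem_Icc.2 ht) (right_mem_Icc.2 ht) ht
  have hlim := tendsto_rpow_mul_exp_neg_mul_atTop_nhds_zero (2 / (1 - α)) ε hε0
  have hpos : 0 < Real.exp (-ε * 1) * U 1 := mul_pos (Real.exp_pos _) (h.fst_pos one_pos)
  refine hpos.not_ge (ge_of_tendsto hlim ?_)
  filter_upwards [Filter.eventually_ge_atTop 1] with t ht
  calc Real.exp (-ε * 1) * U 1 ≤ Real.exp (-ε * t) * U t := hle t ht
    _ ≤ Real.exp (-ε * t) * t ^ (2 / (1 - α)) :=
      mul_le_mul_of_nonneg_left (h.le_rpow t (by linarith)) (Real.exp_pos _).le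
    _ = _ := mul_comm _ _

theorem exists_ratio_eq (h : IsUniversalProfile α U F) {g : ℝ} (hg : 0 < g) (hg₁ : g < 1) :
    ∃ t, 0 < t ∧ U t / F t = g := by
  obtain ⟨b, hb, hgb⟩ := h.exists_lt_ratio hg hg₁
  -- The bound `U / F ≤ t` gives a left end with ratio at most `g`; the minimum with `b` orders the
  -- interval.
  have ha : U (min g b) / F (min g b) ≤ g := by
    have hm : 0 < min g b := lt_min hg hb
    rw [div_le_iff₀ (h.snd_pos hm)]
    exact (h.fst_le_mul_snd hm.le).trans
      (mul_le_mul_of_nonneg_right (min_le_left _ _) (h.snd_pos hm).le)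
  have hsub : Icc (min g b) b ⊆ Ioi 0 := fun t ht => (lt_min hg hb).trans_le ht.1
  obtain ⟨t, ht, e⟩ := intermediate_value_Icc (min_le_right g b) (h.ratio_continuousOn.mono hsub)
    ⟨ha, hgb⟩
  exact ⟨t, hsub ht, e⟩

/-- Bootstrapping in the system; `x ^ α` is smooth along `U` because `U > 0` there. -/
theorem contDiffOn (h : IsUniversalProfile α U F) : ContDiffOn ℝ ∞ U (Ioi 0) := by
  have hU : deriv U = fun t => F t - U t := funext fun t => (h.deriv_fst t).deriv
  have hF : deriv F = fun t => U t ^ α := funext fun t => (h.deriv_snd t).deriv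
  have key : ∀ n : ℕ, ContDiffOn ℝ n U (Ioi 0) ∧ ContDiffOn ℝ n F (Ioi 0) := by
    intro n
    induction n with
    | zero =>
      exact ⟨contDiffOn_zero.2 h.continuous_fst.continuousOn,
        contDiffOn_zero.2 h.continuous_snd.continuousOn⟩
    | succ n ih =>
      push_cast
      rw [contDiffOn_succ_iff_deriv_of_isOpen isOpen_Ioi,
        contDiffOn_succ_iff_deriv_of_isOpen isOpen_Ioi, hU, hF]
      exact ⟨⟨fun t _ => (h.deriv_fst t).differentiableAt.differentiableWithinAt, by simp,
        ih.2.sub ih.1⟩, fun t _ => (h.deriv_snd t).differentiableAt.differentiableWithinAt, by simp,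
        ih.1.rpow_const_of_ne fun t ht => (h.fst_pos ht).ne'⟩
  exact contDiffOn_infty.2 fun n => (key n).1

end IsUniversalProfile

end CombustionWave

/-! ### Delayed solutions, and their exclusion by smoothness. -/

namespace CombustionWave

namespace IsSystemSolution

variable {α a b : ℝ} {X Y : ℝ → ℝ}

theorem zero (hα : 0 < α) : IsSystemSolution α a b (fun _ => 0) (fun _ => 0) where
  cont_fst := continuousOn_const
  cont_snd := continuousOn_const
  deriv_fst t _ := by simpa using hasDerivAt_const t (0 : ℝ)
  deriv_snd t _ := by simpa [Real.zero_rpow hα.ne'] using hasDerivAt_const t (0 : ℝ)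
  nonneg _ _ := le_rfl

theorem monotoneOn_fst (h : IsSystemSolution α a b X Y) (ha : X a ≤ Y a) :
    MonotoneOn X (Icc a b) := by
  have hm : MonotoneOn (fun t => Real.exp t * (Y t - X t)) (Icc a b) := by
    refine monotoneOn_Icc_of_hasDerivAt (f' := fun t => Real.exp t * X t ^ α)
      (Real.continuous_exp.continuousOn.mul (h.cont_snd.sub h.cont_fst)) ?_ ?_
    · intro t ht
      refine ((Real.hasDerivAt_exp t).mul
        ((h.deriv_snd t ht).sub (h.deriv_fst t ht))).congr_deriv ?_
      simp only [Pi.sub_apply]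
      ring
    · exact fun t ht => mul_nonneg (Real.exp_pos t).le
        (Real.rpow_nonneg (h.nonneg t (Ioo_subset_Icc_self ht)) _)
  refine monotoneOn_Icc_of_hasDerivAt h.cont_fst h.deriv_fst fun t ht => ?_
  have h1 := hm (left_mem_Icc.2 (ht.1.trans ht.2).le) (Ioo_subset_Icc_self ht) ht.1.le
  have h2 : 0 ≤ Real.exp t * (Y t - X t) :=
    le_trans (mul_nonneg (Real.exp_pos a).le (by linarith)) h1
  exact nonneg_of_mul_nonneg_right h2 (Real.exp_pos t)

/-- A solution with zero initial data which ends at a positive value vanishes on some interval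
`[0, t₀]` and is the universal profile translated by `t₀` afterwards. -/
theorem exists_eq_translate (hα : 0 < α) (hα₁ : α < 1) {U F : ℝ → ℝ}
    (hU : IsUniversalProfile α U F) (hb : 0 < b)
    (h : IsSystemSolution α 0 b X Y) (hX : X 0 = 0) (hY : Y 0 = 0) (hXb : 0 < X b) :
    ∃ t₀ ∈ Ico 0 b, (∀ t ∈ Icc 0 t₀, X t = 0) ∧
      ∀ t ∈ Icc 0 (b - t₀), X (t₀ + t) = U t ∧ Y (t₀ + t) = F t := by
  have hmono := h.monotoneOn_fst (hX.trans hY.symm).le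
  have hcl : IsCompact (Icc 0 b ∩ X ⁻¹' {0}) :=
    isCompact_Icc.of_isClosed_subset
      (h.cont_fst.preimage_isClosed_of_isClosed isClosed_Icc isClosed_singleton) inter_subset_left
  -- The delay `t₀` is the last zero of `X`; monotonicity makes `X` vanish on all of `[0, t₀]`.
  obtain ⟨t₀, ⟨ht₀, hXt₀⟩, hgr⟩ := hcl.exists_isGreatest ⟨0, ⟨le_rfl, hb.le⟩, hX⟩
  have hXt₀' : X t₀ = 0 := hXt₀
  have hlt : t₀ < b := ht₀.2.lt_of_ne (by rintro rfl; exact hXb.ne' hXt₀')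
  have hz : ∀ t ∈ Icc 0 t₀, X t = 0 := fun t ht =>
    le_antisymm ((hmono ⟨ht.1, ht.2.trans hlt.le⟩ ht₀ ht.2).trans hXt₀'.le)
      (h.nonneg t ⟨ht.1, ht.2.trans hlt.le⟩)
  have hYt₀ : Y t₀ = 0 := by
    refine le_antisymm ?_ ?_
    -- Comparison with the zero solution, on `[0, t₀]` where `X` vanishes, gives `Y t₀ ≤ 0`.
    · have := (rpow_mul_le hα.le (zero hα (a := 0) (b := t₀)) (h.mono le_rfl hlt.le) le_rfl le_rfl
        hX hY zero_le_one (fun t ht => by rw [hz t ht, mul_zero]) t₀ ⟨ht₀.1, le_rfl⟩).1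
      rwa [Real.one_rpow, one_mul] at this
    · rw [← hY]
      exact h.monotoneOn_snd ⟨le_rfl, hb.le⟩ ht₀ ht₀.1
  refine ⟨t₀, ⟨ht₀.1, hlt⟩, hz, fun t ht => ?_⟩
  have hs := (h.comp_sub (-t₀)).mono (a' := 0) (b' := b - t₀) (by linarith [ht₀.1]) (by linarith)
  have hpos : ∀ t ∈ Ioc 0 (b - t₀), 0 < X (t - -t₀) := by
    intro t ht
    have hmem : t - -t₀ ∈ Icc 0 b := ⟨by linarith [ht₀.1, ht.1], by linarith [ht.2]⟩
    refine (h.nonneg _ hmem).lt_of_ne fun h0 => ?_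
    have := hgr ⟨hmem, h0.symm⟩
    linarith [ht.1]
  have e := eqOn_of_pos hα.le hα₁ hs (hU.isSystemSolution 0 (b - t₀)) hpos
    (fun t ht => hU.fst_pos ht.1) (by simpa using hXt₀') (by simpa using hYt₀)
    (hU.fst_eq_zero 0 le_rfl) (hU.snd_eq_zero 0 le_rfl) t ht
  rwa [sub_neg_eq_add, add_comm t t₀] at e

end IsSystemSolution

/-- A smooth function vanishing on the right of `x` is flat at `x`. -/
theorem exists_abs_le_mul_pow {p q x δ : ℝ} (hp : p < x - δ) (hδ : 0 ≤ δ) (hq : x < q) (n : ℕ) :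
    ∀ f : ℝ → ℝ, ContDiffOn ℝ ∞ f (Ioo p q) → (∀ y ∈ Ioo x q, f y = 0) →
      ∃ C, 0 ≤ C ∧ ∀ s ∈ Icc 0 δ, |f (x - s)| ≤ C * s ^ n := by
  induction n with
  | zero =>
    intro f hf _
    have hsub : Icc (x - δ) x ⊆ Ioo p q := fun y hy => ⟨by linarith [hy.1], by linarith [hy.2]⟩
    obtain ⟨C, hC⟩ := isCompact_Icc.exists_bound_of_continuousOn (hf.continuousOn.mono hsub)
    refine ⟨C, (norm_nonneg _).trans (hC x ⟨by linarith, le_rfl⟩), fun s hs => ?_⟩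
    rw [pow_zero, mul_one]
    exact hC _ ⟨by linarith [hs.2], by linarith [hs.1]⟩
  | succ n ih =>
    intro f hf hz
    have hd : ContDiffOn ℝ ∞ (deriv f) (Ioo p q) :=
      hf.deriv_of_isOpen isOpen_Ioo (by simp)
    have hdz : ∀ y ∈ Ioo x q, deriv f y = 0 := by
      intro y hy
      have : f =ᶠ[nhds y] fun _ => 0 := by
        filter_upwards [isOpen_Ioo.mem_nhds hy] with z hz'
        exact hz z hz'
      rw [this.deriv_eq, deriv_const]
    obtain ⟨C, hC0, hC⟩ := ih (deriv f) hd hdz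
    have hx : x ∈ Ioo p q := ⟨by linarith, hq⟩
    have hfx : f x = 0 := by
      have hc : Filter.Tendsto f (nhdsWithin x (Ioi x)) (nhds (f x)) :=
        (hf.continuousOn.continuousAt (isOpen_Ioo.mem_nhds hx)).tendsto.mono_left
          nhdsWithin_le_nhds
      refine tendsto_nhds_unique hc (tendsto_const_nhds.congr' ?_)
      filter_upwards [Ioo_mem_nhdsGT hq] with y hy
      exact (hz y hy).symm
    refine ⟨C, hC0, fun s hs => ?_⟩
    have hsub : ∀ y ∈ Icc (x - s) x, y ∈ Ioo p q := fun y hy =>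
      ⟨by linarith [hy.1, hs.2], by linarith [hy.2]⟩
    have := (convex_Icc (x - s) x).norm_image_sub_le_of_norm_deriv_le (f := f) (C := C * s ^ n)
      (fun y hy => (hf.differentiableOn (by simp)).differentiableAt
        (isOpen_Ioo.mem_nhds (hsub y hy)))
      (fun y hy => ?_) (right_mem_Icc.2 (by linarith [hs.1])) (left_mem_Icc.2 (by linarith [hs.1]))
    · rw [hfx, sub_zero] at this
      refine this.trans_eq ?_
      rw [Real.norm_eq_abs, sub_sub_cancel_left, abs_neg, abs_of_nonneg hs.1]
      ring
    · have h1 := hC (x - y) ⟨by linarith [hy.2], by linarith [hy.1, hs.2]⟩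
      rw [sub_sub_cancel] at h1
      refine h1.trans (mul_le_mul_of_nonneg_left ?_ hC0)
      exact pow_le_pow_left₀ (by linarith [hy.2]) (by linarith [hy.1]) n

/-- A function bounded below by a power on the left of a point and zero on the right is not smooth. -/
theorem not_contDiffOn_of_mul_rpow_le {p q x δ a m : ℝ} (hp : p < x - δ) (hδ : 0 < δ) (hq : x < q)
    (ha : 0 < a) {f : ℝ → ℝ} (hz : ∀ y ∈ Ioo x q, f y = 0)
    (hle : ∀ s ∈ Icc 0 δ, a * s ^ m ≤ f (x - s)) : ¬ ContDiffOn ℝ ∞ f (Ioo p q) := by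
  intro hf
  -- Flatness of order `n > m` forces `a ≤ C * s ^ (n - m)`, which tends to `0` with `s`.
  obtain ⟨n, hn⟩ := exists_nat_gt m
  obtain ⟨C, -, hC⟩ := exists_abs_le_mul_pow hp hδ.le hq n f hf hz
  have hlim : Filter.Tendsto (fun s : ℝ => C * s ^ ((n : ℝ) - m)) (nhdsWithin 0 (Ioi 0))
      (nhds (C * 0)) := by
    refine Filter.Tendsto.const_mul _ ?_
    have := (Real.continuousAt_rpow_const 0 ((n : ℝ) - m) (Or.inr (by linarith))).tendsto
    rw [Real.zero_rpow (by linarith)] at this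
    exact this.mono_left nhdsWithin_le_nhds
  rw [mul_zero] at hlim
  refine ha.not_ge (ge_of_tendsto hlim ?_)
  filter_upwards [Ioo_mem_nhdsGT hδ] with s hs
  have hs' := Ioo_subset_Icc_self hs
  have h1 : a * s ^ m ≤ C * s ^ n := (hle s hs').trans ((le_abs_self _).trans (hC s hs'))
  rw [Real.rpow_sub hs.1, Real.rpow_natCast, ← mul_div_assoc, le_div_iff₀ (Real.rpow_pos_of_pos hs.1 _)]
  exact h1

/-! ### Every solution is a rescaled universal profile. -/

section Representation

variable {α Λ : ℝ} {U F : ℝ → ℝ}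

/-- The scaling factor `c / Λ` of the solution whose rescaled free boundary is `T`. -/
noncomputable def scale (α Λ : ℝ) (F : ℝ → ℝ) (T : ℝ) : ℝ := √(F T ^ (1 - α) / Λ)

theorem scale_pos (hU : IsUniversalProfile α U F) (hΛ : 0 < Λ) {T : ℝ} (hT : 0 < T) :
    0 < scale α Λ F T :=
  Real.sqrt_pos.2 (div_pos (Real.rpow_pos_of_pos (hU.snd_pos hT) _) hΛ)

theorem mul_scale_sq (hU : IsUniversalProfile α U F) (hΛ : 0 < Λ) {T : ℝ} (hT : 0 < T) :
    Λ * scale α Λ F T ^ 2 = F T ^ (1 - α) := by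
  rw [scale, Real.sq_sqrt (div_nonneg (Real.rpow_nonneg (hU.snd_pos hT).le _) hΛ.le)]
  field_simp

/-- The solution whose rescaled free boundary is `T`. -/
noncomputable def rescaled (α Λ : ℝ) (U F : ℝ → ℝ) (T ξ : ℝ) : ℝ :=
  U (scale α Λ F T * (T / scale α Λ F T - ξ)) / F T

theorem isScalarSolution_rescaled (hU : IsUniversalProfile α U F)
    (hΛ : 0 < Λ) {T : ℝ} (hT : 0 < T) :
    IsScalarSolution α Λ (U T / F T) (Λ * scale α Λ F T) (T / scale α Λ F T)
      (rescaled α Λ U F T) := by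
  have hκ := scale_pos hU hΛ hT
  have hκ2 := mul_scale_sq hU hΛ hT
  have hF := hU.snd_pos hT
  unfold rescaled
  set κ := scale α Λ F T with hκdef
  have hR : 0 < T / κ := div_pos hT hκ
  have hlin : ∀ ξ, HasDerivAt (fun ξ => κ * (T / κ - ξ)) (-κ) ξ := fun ξ => by
    simpa using ((hasDerivAt_id ξ).const_sub (T / κ)).const_mul κ
  have hd1 : ∀ ξ, HasDerivAt (fun ξ => U (κ * (T / κ - ξ)) / F T)
      ((F (κ * (T / κ - ξ)) - U (κ * (T / κ - ξ))) * -κ / F T) ξ := fun ξ =>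
    ((hU.deriv_fst _).comp ξ (hlin ξ)).div_const _
  have hd1' : deriv (fun ξ => U (κ * (T / κ - ξ)) / F T) =
      fun ξ => (F (κ * (T / κ - ξ)) - U (κ * (T / κ - ξ))) * -κ / F T :=
    funext fun ξ => (hd1 ξ).deriv
  have hd2 : ∀ ξ, HasDerivAt (fun ξ => (F (κ * (T / κ - ξ)) - U (κ * (T / κ - ξ))) * -κ / F T)
      ((U (κ * (T / κ - ξ)) ^ α - (F (κ * (T / κ - ξ)) - U (κ * (T / κ - ξ)))) * -κ * -κ / F T) ξ :=
    fun ξ => ((((hU.deriv_snd _).sub (hU.deriv_fst _)).comp ξ (hlin ξ)).mul_const _).div_const _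
  have huniq := uniqueDiffOn_Icc hR
  have h0 : κ * (T / κ - 0) = T := by field_simp; ring
  have h1 : κ * (T / κ - T / κ) = 0 := by ring
  refine ⟨mul_pos hΛ hκ, hR, ?_, ?_, ?_, ?_, ?_, ?_, ?_, ?_⟩
  · refine ContDiffOn.div_const (hU.contDiffOn.comp (t := Ioi 0) ?_ ?_) _
    · exact (contDiff_const.mul (contDiff_const.sub contDiff_id)).contDiffOn
    · exact fun ξ hξ => mul_pos hκ (sub_pos.2 hξ.2)
  · refine ContDiff.contDiffOn (contDiff_one_iff_deriv.2
      ⟨fun ξ => (hd1 ξ).differentiableAt, ?_⟩)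
    rw [hd1']
    exact continuous_iff_continuousAt.2 fun ξ => (hd2 ξ).continuousAt
  · exact fun ξ _ => div_nonneg (hU.fst_nonneg _) hF.le
  · intro ξ _
    rw [hd1', (hd2 ξ).deriv]
    beta_reduce
    rw [Real.div_rpow (hU.fst_nonneg _) hF.le]
    have e : F T = F T ^ α * F T ^ (1 - α) := by rw [← Real.rpow_add hF]; simp
    have hα0 : F T ^ α ≠ 0 := (Real.rpow_pos_of_pos hF _).ne'
    have hF0 : F T ≠ 0 := hF.ne'
    rw [← hκ2] at e
    rw [eq_div_iff hα0]
    generalize U (κ * (T / κ - ξ)) = u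
    generalize F (κ * (T / κ - ξ)) = f
    field_simp
    linear_combination -u ^ α * e
  · rw [h0]
  · rw [(hd1 0).hasDerivWithinAt.derivWithin (huniq 0 ⟨le_rfl, hR.le⟩), h0]
    field_simp
  · rw [h1, hU.fst_eq_zero 0 le_rfl, zero_div]
  · rw [(hd1 _).hasDerivWithinAt.derivWithin (huniq _ ⟨hR.le, le_rfl⟩), h1,
      hU.fst_eq_zero 0 le_rfl, hU.snd_eq_zero 0 le_rfl]
    simp

namespace IsScalarSolution

variable {v₀ c R : ℝ} {v : ℝ → ℝ}

theorem hasDerivAt (h : IsScalarSolution α Λ v₀ c R v) {ξ : ℝ} (hξ : ξ ∈ Ioo 0 R) :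
    HasDerivAt v (derivWithin v (Icc 0 R) ξ) ξ :=
  ((h.contDiffOn_one.differentiableOn (by simp)) ξ
    (Ioo_subset_Icc_self hξ)).hasDerivWithinAt.hasDerivAt (Icc_mem_nhds hξ.1 hξ.2)

theorem hasDerivAt_derivWithin (h : IsScalarSolution α Λ v₀ c R v) (hΛ : 0 < Λ) {ξ : ℝ}
    (hξ : ξ ∈ Ioo 0 R) :
    HasDerivAt (derivWithin v (Icc 0 R))
      ((v ξ ^ α + c * derivWithin v (Icc 0 R) ξ) / Λ) ξ := by
  have hs : ContDiffOn ℝ ∞ (deriv v) (Ioo 0 R) :=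
    (h.smooth.mono Ioo_subset_Ico_self).deriv_of_isOpen isOpen_Ioo (by simp)
  have hd := ((hs.differentiableOn (by simp)).differentiableAt
    (isOpen_Ioo.mem_nhds hξ)).hasDerivAt
  have heq : derivWithin v (Icc 0 R) =ᶠ[nhds ξ] deriv v := by
    filter_upwards [isOpen_Ioo.mem_nhds hξ] with y hy
    exact (h.hasDerivAt hy).deriv.symm
  refine (hd.congr_of_eventuallyEq heq).congr_deriv ?_
  rw [eq_div_iff hΛ.ne', ← h.ode ξ hξ, (h.hasDerivAt hξ).deriv]
  ring

/-- Reversing `ξ` from the free boundary turns the two conditions at `R` into zero initial data;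
`hAκ` is the amplitude normalization that removes all coefficients. -/
theorem isSystemSolution (h : IsScalarSolution α Λ v₀ c R v) (hΛ : 0 < Λ) {κ A : ℝ} (hκ : 0 < κ)
    (hA : 0 < A) (hc : c = Λ * κ) (hAκ : Λ * κ ^ 2 * A = A ^ α) :
    IsSystemSolution α 0 (κ * R) (fun t => v (R - t / κ) / A)
      (fun t => v (R - t / κ) / A - derivWithin v (Icc 0 R) (R - t / κ) / (κ * A)) := by
  have hlin : ∀ t, HasDerivAt (fun t => R - t / κ) (-(1 / κ)) t := fun t => by
    simpa using ((hasDerivAt_id t).div_const κ).const_sub R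
  have hmaps : MapsTo (fun t => R - t / κ) (Icc 0 (κ * R)) (Icc 0 R) := by
    intro t ht
    have h1 : 0 ≤ t / κ := div_nonneg ht.1 hκ.le
    have h2 : t / κ ≤ R := (div_le_iff₀' hκ).2 ht.2
    exact ⟨by linarith, by linarith⟩
  have hmaps' : ∀ t ∈ Ioo 0 (κ * R), R - t / κ ∈ Ioo 0 R := by
    intro t ht
    have h1 : 0 < t / κ := div_pos ht.1 hκ
    have h2 : t / κ < R := (div_lt_iff₀' hκ).2 ht.2
    exact ⟨by linarith, by linarith⟩
  have hcl : ContinuousOn (fun t => R - t / κ) (Icc 0 (κ * R)) := by fun_prop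
  have hcv := (h.contDiffOn_one.continuousOn.comp hcl hmaps).div_const A
  have hcw := ((h.contDiffOn_one.continuousOn_derivWithin (uniqueDiffOn_Icc h.R_pos)
    (by simp)).comp hcl hmaps).div_const (κ * A)
  have hd1 : ∀ t ∈ Ioo 0 (κ * R), HasDerivAt (fun t => v (R - t / κ) / A)
      (derivWithin v (Icc 0 R) (R - t / κ) * -(1 / κ) / A) t := fun t ht =>
    ((h.hasDerivAt (hmaps' t ht)).comp t (hlin t)).div_const A
  refine ⟨hcv, hcv.sub hcw, fun t ht => ?_, fun t ht => ?_, fun t ht => ?_⟩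
  · refine (hd1 t ht).congr_deriv ?_
    field_simp
    ring
  · refine ((hd1 t ht).sub (((h.hasDerivAt_derivWithin hΛ (hmaps' t ht)).comp t
      (hlin t)).div_const (κ * A))).congr_deriv ?_
    rw [Real.div_rpow (h.nonneg _ (Ioo_subset_Icc_self (hmaps' t ht))) hA.le, ← hAκ, hc]
    field_simp
    ring
  · exact div_nonneg (h.nonneg _ (hmaps ht)) hA.le

theorem exists_eq_rescaled (h : IsScalarSolution α Λ v₀ c R v) (hα : 0 < α) (hα₁ : α < 1)
    (hΛ : 0 < Λ) (hU : IsUniversalProfile α U F) (hv₀ : 0 < v₀) :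
    ∃ T, 0 < T ∧ U T / F T = v₀ ∧ c = Λ * scale α Λ F T ∧ R = T / scale α Λ F T ∧
      EqOn v (rescaled α Λ U F T) (Icc 0 R) := by
  have h1α : 0 < 1 - α := by linarith
  have hR := h.R_pos
  set κ := c / Λ with hκdef
  have hκ : 0 < κ := div_pos h.c_pos hΛ
  have hc : c = Λ * κ := by rw [hκdef]; field_simp
  have hB : 0 < (Λ * κ ^ 2)⁻¹ := by positivity
  set A := ((Λ * κ ^ 2)⁻¹) ^ (1 / (1 - α)) with hAdef
  have hA : 0 < A := Real.rpow_pos_of_pos hB _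
  have hA1 : A ^ (1 - α) = (Λ * κ ^ 2)⁻¹ := by
    rw [hAdef, ← Real.rpow_mul hB.le, one_div_mul_cancel h1α.ne', Real.rpow_one]
  have hAκ : Λ * κ ^ 2 * A = A ^ α := by
    have : A = A ^ α * A ^ (1 - α) := by rw [← Real.rpow_add hA]; simp
    nth_rewrite 1 [this]
    rw [hA1]
    field_simp
  have hsys := h.isSystemSolution hΛ hκ hA hc hAκ
  have hT : 0 < κ * R := mul_pos hκ hR
  have hend : R - κ * R / κ = 0 := by field_simp; ring
  obtain ⟨t₀, ht₀, hz, heq⟩ := hsys.exists_eq_translate hα hα₁ hU hT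
    (by simp [h.value_R]) (by simp [h.value_R, h.deriv_R])
    (by simp only [hend, h.value_zero]; exact div_pos hv₀ hA)
  -- A positive delay would make `v` vanish on `(R - t₀ / κ, R)` and behave at least like a power
  -- just to the left, at a point inside `(0, R)` where `v` is smooth.
  have ht₀0 : t₀ = 0 := by
    by_contra hne
    have ht₀pos : 0 < t₀ := ht₀.1.lt_of_ne (Ne.symm hne)
    obtain ⟨a, ha, hle⟩ := hU.exists_rpow_le (κ * R) hT
    have hx : 0 < R - t₀ / κ := by
      have : t₀ / κ < R := (div_lt_iff₀' hκ).2 ht₀.2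
      linarith
    have hκm : 0 < κ ^ (2 / (1 - α)) := Real.rpow_pos_of_pos hκ _
    refine not_contDiffOn_of_mul_rpow_le (p := 0) (q := R) (x := R - t₀ / κ)
      (δ := (R - t₀ / κ) / 2) (a := A * (a * κ ^ (2 / (1 - α)))) (m := 2 / (1 - α))
      (by linarith) (by linarith) (by linarith [div_pos ht₀pos hκ]) (by positivity) ?_ ?_
      (h.smooth.mono Ioo_subset_Ico_self)
    · intro y hy
      have := hz (κ * (R - y)) ⟨mul_nonneg hκ.le (by linarith [hy.2]), by
        have h1 : R - y < t₀ / κ := by linarith [hy.1]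
        exact ((lt_div_iff₀' hκ).1 h1).le⟩
      have e : R - κ * (R - y) / κ = y := by field_simp; ring
      rw [e, div_eq_zero_iff] at this
      exact this.resolve_right hA.ne'
    · intro s hs
      have hκs : 0 ≤ κ * s := mul_nonneg hκ.le hs.1
      have hs1 : κ * s ≤ κ * R - t₀ := by
        have h1 : s ≤ R - t₀ / κ := by linarith [hs.2]
        calc κ * s ≤ κ * (R - t₀ / κ) := mul_le_mul_of_nonneg_left h1 hκ.le
          _ = κ * R - t₀ := by field_simp
      have h1 := (heq (κ * s) ⟨hκs, hs1⟩).1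
      have h2 := hle (κ * s) ⟨hκs, by linarith⟩
      have e : R - (t₀ + κ * s) / κ = R - t₀ / κ - s := by field_simp; ring
      rw [← h1, e, Real.mul_rpow hκ.le hs.1, le_div_iff₀ hA] at h2
      linarith
  subst ht₀0
  simp only [zero_add, sub_zero] at heq
  obtain ⟨eX, eY⟩ := heq (κ * R) ⟨hT.le, le_rfl⟩
  have hcΛ : c / Λ = κ := rfl
  rw [hend, h.value_zero] at eX
  rw [hend, h.value_zero, h.deriv_zero, hcΛ] at eY
  -- In `Y = X + X'` the condition `v'(0) = -κ (1 - v₀)` cancels `v₀`, so the amplitude is read off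
  -- from `F`.
  have hF : F (κ * R) = 1 / A := by
    rw [← eY]; field_simp; ring
  have hκs : scale α Λ F (κ * R) = κ := by
    rw [scale, hF, one_div, Real.inv_rpow hA.le, hA1, inv_inv, mul_div_cancel_left₀ _ hΛ.ne',
      Real.sqrt_sq hκ.le]
  refine ⟨κ * R, hT, ?_, ?_, ?_, ?_⟩
  · rw [← eX, hF]; field_simp
  · rw [hκs, hc]
  · rw [hκs]; field_simp
  · intro ξ hξ
    have e1 : κ * (κ * R / κ - ξ) = κ * (R - ξ) := by field_simp
    have e2 : R - κ * (R - ξ) / κ = ξ := by field_simp; ring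
    have := (heq (κ * (R - ξ)) ⟨mul_nonneg hκ.le (by linarith [hξ.2]),
      mul_le_mul_of_nonneg_left (by linarith [hξ.1]) hκ.le⟩).1
    rw [rescaled, hκs, e1, ← this, e2, hF]
    field_simp

end IsScalarSolution

end Representation

end CombustionWave

/-! ### The integral equation and the fixed point. -/

namespace CombustionWave

theorem pos_of_mem_I {θ Λ : ℝ} (hθ₁ : θ < 1) (hΛ : 1 < Λ) {v₀ : ℝ} (h : v₀ ∈ I θ Λ) : 0 < v₀ :=
  (div_pos (by linarith) (by linarith)).trans_le h.1

theorem lt_one_of_mem_I {θ Λ : ℝ} (hθ₀ : 0 < θ) (hΛ : 1 < Λ) {v₀ : ℝ} (h : v₀ ∈ I θ Λ) : v₀ < 1 := by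
  have h1 : 0 < θ / Λ := div_pos hθ₀ (by linarith)
  have h2 := h.2
  linarith

/-- Integration by parts: as `v(R) = 0`, `c ∫ e^{-c s} v = v(0) + ∫ e^{-c s} v'`. -/
theorem integralEqDeriv_of_integralEq {α θ Λ v₀ c R : ℝ} {v : ℝ → ℝ}
    (h : IsScalarSolution α Λ v₀ c R v) (hv : IntegralEq θ Λ c R v) :
    IntegralEqDeriv θ Λ c R v := by
  have hR := h.R_pos.le
  have hc1 : ContinuousOn v (Icc 0 R) := h.contDiffOn_one.continuousOn
  have hc2 : ContinuousOn (derivWithin v (Icc 0 R)) (Icc 0 R) :=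
    h.contDiffOn_one.continuousOn_derivWithin (uniqueDiffOn_Icc h.R_pos) (by simp)
  have he : ContinuousOn (fun s => Real.exp (-c * s)) (Icc 0 R) := by fun_prop
  have hi1 : IntervalIntegrable (fun s => Real.exp (-c * s) * v s) MeasureTheory.volume 0 R :=
    ContinuousOn.intervalIntegrable (by rw [uIcc_of_le hR]; exact he.mul hc1)
  have hi2 : IntervalIntegrable (fun s => Real.exp (-c * s) * derivWithin v (Icc 0 R) s)
      MeasureTheory.volume 0 R :=
    ContinuousOn.intervalIntegrable (by rw [uIcc_of_le hR]; exact he.mul hc2)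
  have hparts := intervalIntegral.integral_eq_sub_of_hasDerivAt_of_le hR (he.mul hc1)
    (f' := fun s => -c * (Real.exp (-c * s) * v s) + Real.exp (-c * s) * derivWithin v (Icc 0 R) s)
    (fun s hs => by
      refine ((((hasDerivAt_id s).const_mul (-c)).exp).mul (h.hasDerivAt hs)).congr_deriv ?_
      simp only [id]
      ring) ((hi1.const_mul _).add hi2)
  rw [intervalIntegral.integral_add (hi1.const_mul _) hi2,
    intervalIntegral.integral_const_mul] at hparts
  simp only [Pi.mul_apply, h.value_R, mul_zero, Real.exp_zero, one_mul, zero_sub] at hparts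
  unfold IntegralEq at hv
  unfold IntegralEqDeriv
  linear_combination hv + (1 - Λ) * hparts

section Moment

variable {α Λ : ℝ} {U F : ℝ → ℝ}

/-- The quantity `c ∫₀^R e^{-c s} v(s) ds` as a function of the rescaled free boundary. -/
noncomputable def moment (Λ : ℝ) (U F : ℝ → ℝ) (T : ℝ) : ℝ :=
  Λ * Real.exp (-Λ * T) * (∫ r in (0 : ℝ)..T, Real.exp (Λ * r) * U r) / F T

theorem hasDerivAt_integral_exp_mul (hU : IsUniversalProfile α U F) (T : ℝ) :
    HasDerivAt (fun T => ∫ r in (0 : ℝ)..T, Real.exp (Λ * r) * U r) (Real.exp (Λ * T) * U T) T := by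
  have := hU.continuous_fst
  exact ((show Continuous fun r => Real.exp (Λ * r) * U r by fun_prop).integral_hasStrictDerivAt
    0 T).hasDerivAt

theorem moment_continuousOn (hU : IsUniversalProfile α U F) :
    ContinuousOn (moment Λ U F) (Ioi 0) := by
  have h : Continuous fun T => ∫ r in (0 : ℝ)..T, Real.exp (Λ * r) * U r :=
    continuous_iff_continuousAt.2 fun T => (hasDerivAt_integral_exp_mul hU T).continuousAt
  refine ContinuousOn.div (Continuous.continuousOn ?_) hU.continuous_snd.continuousOn
    fun T hT => (hU.snd_pos hT).ne'
  fun_prop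

theorem moment_nonneg (hU : IsUniversalProfile α U F) (hΛ : 0 < Λ) {T : ℝ} (hT : 0 < T) :
    0 ≤ moment Λ U F T := by
  refine div_nonneg (mul_nonneg (by positivity) ?_) (hU.snd_pos hT).le
  exact intervalIntegral.integral_nonneg hT.le fun r _ =>
    mul_nonneg (Real.exp_pos _).le (hU.fst_nonneg r)

/-- Integrating by parts, the deficit is a positive multiple of `∫ exp (Λ r) U'(r) dr`, and `U' >
0`. -/
theorem moment_le_ratio (hU : IsUniversalProfile α U F) (hΛ : 0 < Λ) {T : ℝ} (hT : 0 < T) :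
    moment Λ U F T ≤ U T / F T := by
  have hm : MonotoneOn (fun T => Real.exp (Λ * T) * U T / Λ -
      ∫ r in (0 : ℝ)..T, Real.exp (Λ * r) * U r) (Icc 0 T) := by
    have hd : ∀ T, HasDerivAt (fun T => Real.exp (Λ * T) * U T / Λ -
        ∫ r in (0 : ℝ)..T, Real.exp (Λ * r) * U r) (Real.exp (Λ * T) * (F T - U T) / Λ) T := by
      intro T
      refine ((((((hasDerivAt_id T).const_mul Λ).exp).mul (hU.deriv_fst T)).div_const Λ).sub
        (hasDerivAt_integral_exp_mul hU T)).congr_deriv ?_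
      simp only [id]
      field_simp
      ring
    refine monotoneOn_Icc_of_hasDerivAt
      (fun t _ => (hd t).continuousAt.continuousWithinAt) (fun t _ => hd t) fun t ht => ?_
    exact div_nonneg (mul_nonneg (Real.exp_pos _).le
      (sub_nonneg.2 (hU.fst_lt_snd ht.1).le)) hΛ.le
  have h0 := hm (left_mem_Icc.2 hT.le) (right_mem_Icc.2 hT.le) hT.le
  simp only [hU.fst_eq_zero 0 le_rfl, intervalIntegral.integral_same, mul_zero, zero_div,
    sub_zero] at h0
  refine div_le_div_of_nonneg_right ?_ (hU.snd_pos hT).le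
  have e : Real.exp (-Λ * T) * Real.exp (Λ * T) = 1 := by rw [← Real.exp_add]; simp
  calc Λ * Real.exp (-Λ * T) * (∫ r in (0 : ℝ)..T, Real.exp (Λ * r) * U r)
      ≤ Λ * Real.exp (-Λ * T) * (Real.exp (Λ * T) * U T / Λ) := by gcongr; linarith
    _ = Real.exp (-Λ * T) * Real.exp (Λ * T) * U T := by field_simp
    _ = U T := by rw [e, one_mul]

/-- Under `r = T - κ s` the exponent `c s` becomes `Λ (T - r)`, and the factor `κ` in `c` cancels
the Jacobian. -/
theorem mul_integral_rescaled (hU : IsUniversalProfile α U F) (hΛ : 0 < Λ) {T : ℝ} (hT : 0 < T) :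
    Λ * scale α Λ F T * ∫ s in (0 : ℝ)..T / scale α Λ F T,
      Real.exp (-(Λ * scale α Λ F T) * s) * rescaled α Λ U F T s = moment Λ U F T := by
  have hκ := scale_pos hU hΛ hT
  unfold rescaled
  set κ := scale α Λ F T
  have hsub := intervalIntegral.integral_comp_sub_mul
    (fun r => Real.exp (-Λ * T) * (Real.exp (Λ * r) * U r) / F T) hκ.ne' T (a := 0) (b := T / κ)
  have e1 : T - κ * (T / κ) = 0 := by field_simp; ring
  rw [e1, mul_zero, sub_zero, intervalIntegral.integral_div, intervalIntegral.integral_const_mul,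
    smul_eq_mul] at hsub
  have e2 : ∫ s in (0 : ℝ)..T / κ, Real.exp (-(Λ * κ) * s) * (U (κ * (T / κ - s)) / F T) =
      ∫ s in (0 : ℝ)..T / κ,
        Real.exp (-Λ * T) * (Real.exp (Λ * (T - κ * s)) * U (T - κ * s)) / F T := by
    congr 1
    funext s
    rw [← mul_assoc, ← Real.exp_add, mul_div_assoc]
    congr 2
    · ring
    · congr 1
      field_simp
  rw [e2, intervalIntegral.integral_div, intervalIntegral.integral_const_mul, hsub,
    intervalIntegral.integral_div, intervalIntegral.integral_const_mul, moment]
  field_simp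

end Moment

theorem isScalarSolution_scalarSolution {α Λ v₀ : ℝ}
    (h : ∃ (c R : ℝ) (v : ℝ → ℝ), IsScalarSolution α Λ v₀ c R v) :
    IsScalarSolution α Λ v₀ (speed α Λ v₀) (radius α Λ v₀) (profile α Λ v₀) := by
  obtain ⟨c, R, v, h⟩ := h
  exact Classical.epsilon_spec
    (p := fun p : ℝ × ℝ × (ℝ → ℝ) => IsScalarSolution α Λ v₀ p.1 p.2.1 p.2.2) ⟨(c, R, v), h⟩

section Existence

variable {α Λ v₀ : ℝ} {U F : ℝ → ℝ}

theorem exists_isScalarSolution (hU : IsUniversalProfile α U F) (hΛ : 0 < Λ) (hv₀ : 0 < v₀)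
    (hv₁ : v₀ < 1) : ∃ (c R : ℝ) (v : ℝ → ℝ), IsScalarSolution α Λ v₀ c R v := by
  obtain ⟨T, hT, rfl⟩ := hU.exists_ratio_eq hv₀ hv₁
  exact ⟨_, _, _, isScalarSolution_rescaled hU hΛ hT⟩

theorem IsScalarSolution.unique (hα : 0 < α) (hα₁ : α < 1) (hΛ : 0 < Λ) (hv₀ : 0 < v₀)
    {c₁ R₁ c₂ R₂ : ℝ} {v₁ v₂ : ℝ → ℝ} (h₁ : IsScalarSolution α Λ v₀ c₁ R₁ v₁)
    (h₂ : IsScalarSolution α Λ v₀ c₂ R₂ v₂) : c₁ = c₂ ∧ R₁ = R₂ ∧ EqOn v₁ v₂ (Icc 0 R₁) := by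
  obtain ⟨U, F, hU⟩ := exists_isUniversalProfile hα hα₁
  obtain ⟨T₁, hT₁, e₁, hc₁, hR₁, hv₁⟩ := h₁.exists_eq_rescaled hα hα₁ hΛ hU hv₀
  obtain ⟨T₂, hT₂, e₂, hc₂, hR₂, hv₂⟩ := h₂.exists_eq_rescaled hα hα₁ hΛ hU hv₀
  obtain rfl : T₁ = T₂ :=
    (hU.ratio_strictMonoOn hα hα₁).injOn hT₁ hT₂ (e₁.trans e₂.symm)
  have hR : R₁ = R₂ := hR₁.trans hR₂.symm
  subst hR
  exact ⟨hc₁.trans hc₂.symm, rfl, fun ξ hξ => (hv₁ hξ).trans (hv₂ hξ).symm⟩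

/-- The triple picked by choice has no evident regularity in `v₀`; the representation identifies its
integral with a function continuous in `T`. -/
theorem speed_mul_integral (hα : 0 < α) (hα₁ : α < 1) (hU : IsUniversalProfile α U F)
    (hΛ : 0 < Λ) (hv₀ : 0 < v₀) (hv₁ : v₀ < 1) {T : ℝ} (hT : 0 < T) (hTv : U T / F T = v₀) :
    speed α Λ v₀ * ∫ s in (0 : ℝ)..radius α Λ v₀,
      Real.exp (-speed α Λ v₀ * s) * profile α Λ v₀ s = moment Λ U F T := by
  have h := isScalarSolution_scalarSolution (exists_isScalarSolution hU hΛ hv₀ hv₁)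
  obtain ⟨T', hT', e, hc, hR, hv⟩ := h.exists_eq_rescaled hα hα₁ hΛ hU hv₀
  obtain rfl : T = T' := (hU.ratio_strictMonoOn hα hα₁).injOn hT hT' (hTv.trans e.symm)
  rw [← mul_integral_rescaled hU hΛ hT, ← hc, ← hR]
  congr 1
  refine intervalIntegral.integral_congr fun s hs => ?_
  rw [uIcc_of_le h.R_pos.le] at hs
  simp only [hv hs]

variable {θ : ℝ}

theorem Psi_eq (hα : 0 < α) (hα₁ : α < 1) (hU : IsUniversalProfile α U F) (hθ₀ : 0 < θ)
    (hθ₁ : θ < 1) (hΛ : 1 < Λ) (v₀ : I θ Λ) {T : ℝ} (hT : 0 < T) (hTv : U T / F T = v₀) :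
    Psi α θ hΛ v₀ = P θ hΛ ((1 / Λ) * (1 - θ + (Λ - 1) * moment Λ U F T)) := by
  rw [← speed_mul_integral hα hα₁ hU (by linarith) (pos_of_mem_I hθ₁ hΛ v₀.2)
    (lt_one_of_mem_I hθ₀ hΛ v₀.2) hT hTv, Psi]
  congr 2
  ring

theorem exists_isFixedPt_Psi (hα : 0 < α) (hα₁ : α < 1) (hθ₀ : 0 < θ) (hθ₁ : θ < 1) (hΛ : 1 < Λ) :
    ∃ v₀ : I θ Λ, Function.IsFixedPt (Psi α θ hΛ) v₀ := by
  obtain ⟨U, F, hU⟩ := exists_isUniversalProfile hα hα₁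
  have hl : (1 - θ) / Λ ∈ I θ Λ := left_mem_Icc.2 (left_le_right θ hΛ)
  have hr : 1 - θ / Λ ∈ I θ Λ := right_mem_Icc.2 (left_le_right θ hΛ)
  have hG := hU.ratio_strictMonoOn hα hα₁
  obtain ⟨T₁, hT₁, e₁⟩ := hU.exists_ratio_eq (pos_of_mem_I hθ₁ hΛ hl) (lt_one_of_mem_I hθ₀ hΛ hl)
  obtain ⟨T₂, hT₂, e₂⟩ := hU.exists_ratio_eq (pos_of_mem_I hθ₁ hΛ hr) (lt_one_of_mem_I hθ₀ hΛ hr)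
  have hT : T₁ ≤ T₂ := by
    refine (hG.le_iff_le hT₁ hT₂).1 ?_
    simp only [e₁, e₂]
    exact left_le_right θ hΛ
  have hsub : Icc T₁ T₂ ⊆ Ioi 0 := fun t ht => lt_of_lt_of_le hT₁ ht.1
  set Q : ℝ → ℝ := fun T => P θ hΛ ((1 / Λ) * (1 - θ + (Λ - 1) * moment Λ U F T)) with hQ
  have hQI : ∀ T, Q T ∈ I θ Λ := fun T => Subtype.property _
  have hQc : ContinuousOn Q (Icc T₁ T₂) := by
    refine (continuous_subtype_val.comp continuous_projIcc).comp_continuousOn ?_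
    have := (moment_continuousOn (Λ := Λ) hU).mono hsub
    fun_prop
  have hc : ContinuousOn (fun T => U T / F T - Q T) (Icc T₁ T₂) :=
    (hU.ratio_continuousOn.mono hsub).sub hQc
  -- At `T₁` and `T₂` the ratio equals the end points of `I`, while `Q` stays in `I`, so the
  -- difference changes sign.
  obtain ⟨T, hTmem, hT0⟩ := intermediate_value_Icc hT hc
    (show (0 : ℝ) ∈ Icc _ _ from ⟨by rw [e₁]; linarith [(hQI T₁).1], by rw [e₂]; linarith [(hQI T₂).2]⟩)
  have heq : U T / F T = Q T := sub_eq_zero.1 hT0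
  refine ⟨⟨U T / F T, heq ▸ hQI T⟩, Subtype.ext ?_⟩
  rw [Psi_eq hα hα₁ hU hθ₀ hθ₁ hΛ _ (hsub hTmem) rfl]
  exact heq.symm

theorem integralEq_of_isFixedPt (hα : 0 < α) (hα₁ : α < 1) (hθ₀ : 0 < θ) (hθ₁ : θ < 1)
    (hΛ : 1 < Λ) {v₀ : I θ Λ} (h : Function.IsFixedPt (Psi α θ hΛ) v₀) :
    IntegralEq θ Λ (speed α Λ v₀) (radius α Λ v₀) (profile α Λ v₀) := by
  have hΛ0 : 0 < Λ := by linarith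
  obtain ⟨U, F, hU⟩ := exists_isUniversalProfile hα hα₁
  have hv₀ := pos_of_mem_I hθ₁ hΛ v₀.2
  have hv₁ := lt_one_of_mem_I hθ₀ hΛ v₀.2
  have hs := isScalarSolution_scalarSolution (exists_isScalarSolution hU hΛ0 hv₀ hv₁)
  obtain ⟨T, hT, e⟩ := hU.exists_ratio_eq hv₀ hv₁
  have hM := speed_mul_integral hα hα₁ hU hΛ0 hv₀ hv₁ hT e
  have hM0 := moment_nonneg hU hΛ0 hT
  have hM1 := moment_le_ratio hU hΛ0 hT
  rw [e] at hM1
  have hfix : P θ hΛ ((1 / Λ) * (1 - θ + (Λ - 1) * moment Λ U F T)) = v₀ := by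
    rw [← Psi_eq hα hα₁ hU hθ₀ hθ₁ hΛ v₀ hT e]
    exact h
  set M := moment Λ U F T
  set x := (1 / Λ) * (1 - θ + (Λ - 1) * M) with hx
  have hΛx : Λ * x = 1 - θ + (Λ - 1) * M := by rw [hx]; field_simp
  have hlx : (1 - θ) / Λ ≤ x := by
    rw [div_le_iff₀' hΛ0, hΛx]
    nlinarith
  -- Amounts to `(Λ - 1) M ≤ Λ - 1`, which holds because `M ≤ v₀ < 1`; the lower bound `hlx` only
  -- needs `M ≥ 0`.
  have hxr : x ≤ 1 - θ / Λ := by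
    have h2 : Λ * (1 - θ / Λ) = Λ - θ := by field_simp
    have h3 : θ / Λ ≤ θ := div_le_self hθ₀.le hΛ.le
    have h4 : M ≤ 1 - θ / Λ := hM1.trans v₀.2.2
    refine le_of_mul_le_mul_left ?_ hΛ0
    rw [hΛx, h2]
    nlinarith
  have hPx : P θ hΛ x = ⟨x, hlx, hxr⟩ := projIcc_of_mem _ ⟨hlx, hxr⟩
  have hxv : x = v₀ := by rw [← hfix, hPx]
  unfold IntegralEq
  rw [hs.value_zero, ← hxv, hΛx, hxv]
  linear_combination (Λ - 1) * (-hM)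

end Existence

end CombustionWave

/-- For every `v₀ ∈ I` the scalar problem has exactly one solution (so `Ψ` is well defined), `Ψ : I → I`
has a fixed point, and for every fixed point `v₀` of `Ψ` the triple `(c(v₀), R(v₀), v(v₀; ·))` solves
the scalar problem with `v(0) = v₀` together with the integral equation, in both of its forms. -/
theorem theorem7p2 (α θ Λ : ℝ) (hα₀ : 0 < α) (hα₁ : α < 1) (hθ₀ : 0 < θ) (hθ₁ : θ < 1) (hΛ : 1 < Λ) :
    (∀ v₀ ∈ CombustionWave.I θ Λ,
      (∃ (c R : ℝ) (v : ℝ → ℝ), CombustionWave.IsScalarSolution α Λ v₀ c R v) ∧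
      ∀ (c₁ R₁ : ℝ) (v₁ : ℝ → ℝ) (c₂ R₂ : ℝ) (v₂ : ℝ → ℝ),
        CombustionWave.IsScalarSolution α Λ v₀ c₁ R₁ v₁ →
        CombustionWave.IsScalarSolution α Λ v₀ c₂ R₂ v₂ →
        c₁ = c₂ ∧ R₁ = R₂ ∧ Set.EqOn v₁ v₂ (Set.Icc 0 R₁)) ∧
    (∃ v₀ : CombustionWave.I θ Λ, Function.IsFixedPt (CombustionWave.Psi α θ hΛ) v₀) ∧
    ∀ v₀ : CombustionWave.I θ Λ, Function.IsFixedPt (CombustionWave.Psi α θ hΛ) v₀ →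
      CombustionWave.SolvesScalarProblem α Λ (CombustionWave.speed α Λ v₀)
        (CombustionWave.radius α Λ v₀) (CombustionWave.profile α Λ v₀) ∧
      CombustionWave.profile α Λ v₀ 0 = v₀ ∧
      CombustionWave.IntegralEq θ Λ (CombustionWave.speed α Λ v₀)
        (CombustionWave.radius α Λ v₀) (CombustionWave.profile α Λ v₀) ∧
      CombustionWave.IntegralEqDeriv θ Λ (CombustionWave.speed α Λ v₀)
        (CombustionWave.radius α Λ v₀) (CombustionWave.profile α Λ v₀) := by
  have hΛ0 : 0 < Λ := by linarith
  obtain ⟨U, F, hU⟩ := CombustionWave.exists_isUniversalProfile hα₀ hα₁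
  have hex : ∀ v₀ ∈ CombustionWave.I θ Λ,
      ∃ (c R : ℝ) (v : ℝ → ℝ), CombustionWave.IsScalarSolution α Λ v₀ c R v := fun v₀ hv =>
    CombustionWave.exists_isScalarSolution hU hΛ0 (CombustionWave.pos_of_mem_I hθ₁ hΛ hv)
      (CombustionWave.lt_one_of_mem_I hθ₀ hΛ hv)
  refine ⟨fun v₀ hv => ⟨hex v₀ hv, fun c₁ R₁ v₁ c₂ R₂ v₂ h₁ h₂ =>
    h₁.unique hα₀ hα₁ hΛ0 (CombustionWave.pos_of_mem_I hθ₁ hΛ hv) h₂⟩,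
    CombustionWave.exists_isFixedPt_Psi hα₀ hα₁ hθ₀ hθ₁ hΛ, fun v₀ hfix => ?_⟩
  have hs := CombustionWave.isScalarSolution_scalarSolution (hex v₀ v₀.2)
  have hint := CombustionWave.integralEq_of_isFixedPt hα₀ hα₁ hθ₀ hθ₁ hΛ hfix
  refine ⟨?_, hs.value_zero, hint, CombustionWave.integralEqDeriv_of_integralEq hs hint⟩
  unfold CombustionWave.SolvesScalarProblem
  rw [hs.value_zero]
  exact ⟨CombustionWave.pos_of_mem_I hθ₁ hΛ v₀.2, CombustionWave.lt_one_of_mem_I hθ₀ hΛ v₀.2, hs⟩
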